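/- Let $k$ be an algebraically closed field, $Q$ a finite quiver, $J(Q)$ the two-sided ideal of the path algebra $kQ$ generated by the arrows, and $I\subseteq kQ$ an admissible ideal, i.e. a two-sided ideal with $J(Q)^{\ell}\subseteq I\subseteq J(Q)^2$ for some $\ell\ge 2$. Let $B=kQ/I$, let $J(B)$ be its Jacobson radical, and let $n=\dim_k B$, which is finite. For a finite-dimensional unital $k$-algebra $C$ and an integer $m\ge 0$, let $\operatorname{AlgGr}_m(C)$ denote the variety of $m$-dimensional unital subalgebras of $C$, a closed subvariety of the Grassmannian $\operatorname{Gr}_m(C)$ with the induced (reduced) structure. (1) Let $1\le m\le n$. Every $m$-dimensional subalgebra $A$ of $B$ contains $J(B)^{2(n-m)}$. The number $\overline{m}=\dim_k\bigl(B/J(B)^{2(n-m)}\bigr)-n+m$ is nonnegative, and the map $A\mapsto A/J(B)^{2(n-m)}$ is an isomorphism of varieties $$\operatorname{AlgGr}_m(B)\;\cong\;\operatorname{AlgGr}_{\overline{m}}\bigl(B/J(B)^{2(n-m)}\bigr).$$ (2) In particular, $\operatorname{AlgGr}_{n-1}(B)$ depends, up to isomorphism of varieties, only on the Ext-quiver $Q$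 of $B$: if $Q'$ is a finite quiver isomorphic to $Q$, $I'\subseteq kQ'$ is an admissible ideal, $B'=kQ'/I'$ and $n'=\dim_k B'$, where $n,n'\ge 1$, then $\operatorname{AlgGr}_{n-1}(B)\cong\operatorname{AlgGr}_{n'-1}(B')$. -/

import Mathlib

noncomputable section

/-! ### The path algebra of a quiver -/

/-- A path of a quiver together with its source and its target. -/
structure QuiverPath (Q : Type*) [Quiver Q] where
  /-- the source of the path -/
  src : Q
  /-- the target of the path -/
  tgt : Q
  /-- the path itself -/
  path : Quiver.Path src tgt

/-- The underlying vector space of the path algebra: the free vector space on the set of all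
paths, including the trivial path at each vertex. -/
def PathAlgebra (k : Type*) (Q : Type*) [Field k] [Quiver Q] : Type _ := QuiverPath Q →₀ k

namespace PathAlgebra

section Basic

variable (k : Type*) {Q : Type*} [Field k] [Quiver Q]

instance : AddCommGroup (PathAlgebra k Q) := inferInstanceAs (AddCommGroup (QuiverPath Q →₀ k))

instance : Module k (PathAlgebra k Q) := inferInstanceAs (Module k (QuiverPath Q →₀ k))

/-- The basis element of the path algebra attached to a path. -/
def ofPath {u v : Q} (p : Quiver.Path u v) : PathAlgebra k Q :=
  Finsupp.single (⟨u, v, p⟩ : QuiverPath Q) (1 : k)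

/-- The paths form a basis of the path algebra. -/
def basis : Module.Basis (QuiverPath Q) k (PathAlgebra k Q) :=
  Module.Basis.ofRepr (LinearEquiv.refl k (QuiverPath Q →₀ k))

theorem basis_apply (p : QuiverPath Q) : basis k p = ofPath k p.path := rfl

open Classical in
/-- The product of two paths: their concatenation (first `p`, then `q`) when the target of `p` is
the source of `q`, and `0` otherwise. -/
def pathMul (p q : QuiverPath Q) : PathAlgebra k Q :=
  if h : p.tgt = q.src then ofPath k (p.path.comp (q.path.cast h.symm rfl)) else 0

/-- The bilinear extension of the product of paths. -/
def mulBilin : PathAlgebra k Q →ₗ[k] PathAlgebra k Q →ₗ[k] PathAlgebra k Q :=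
  (basis k).constr k fun p => (basis k).constr k fun q => pathMul k p q

instance : Mul (PathAlgebra k Q) := ⟨fun x y => mulBilin k x y⟩

variable {k}

theorem mul_def (x y : PathAlgebra k Q) : x * y = mulBilin k x y := rfl

theorem ofPath_mul_ofPath {u v w : Q} (p : Quiver.Path u v) (q : Quiver.Path v w) :
    ofPath k p * ofPath k q = ofPath k (p.comp q) := by
  rw [mul_def, ← basis_apply k ⟨u, v, p⟩, ← basis_apply k ⟨v, w, q⟩]
  simp [mulBilin, pathMul]

theorem ofPath_mul_ofPath_of_ne {u v v' w : Q} (p : Quiver.Path u v) (q : Quiver.Path v' w)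
    (h : v ≠ v') : ofPath k p * ofPath k q = 0 := by
  rw [mul_def, ← basis_apply k ⟨u, v, p⟩, ← basis_apply k ⟨v', w, q⟩]
  simp [mulBilin, pathMul, h]

theorem induct {P : PathAlgebra k Q → Prop} (x : PathAlgebra k Q) (h0 : P 0)
    (hadd : ∀ x y, P x → P y → P (x + y)) (hsmul : ∀ (c : k) x, P x → P (c • x))
    (hpath : ∀ (u v : Q) (p : Quiver.Path u v), P (ofPath k p)) : P x := by
  have hx : x ∈ Submodule.span k (Set.range (basis k (Q := Q))) := by
    rw [(basis k).span_eq]; trivial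
  induction hx using Submodule.span_induction with
  | mem x h => obtain ⟨p, rfl⟩ := h; exact hpath _ _ p.path
  | zero => exact h0
  | add x y _ _ hx hy => exact hadd x y hx hy
  | smul c x _ hx => exact hsmul c x hx

instance : NonUnitalNonAssocRing (PathAlgebra k Q) where
  left_distrib x y z := by simp [mul_def]
  right_distrib x y z := by simp [mul_def]
  zero_mul x := by simp [mul_def]
  mul_zero x := by simp [mul_def]

instance : IsScalarTower k (PathAlgebra k Q) (PathAlgebra k Q) :=
  ⟨fun c x y => by simp [mul_def]⟩

instance : SMulCommClass k (PathAlgebra k Q) (PathAlgebra k Q) :=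
  ⟨fun c x y => by simp [mul_def]⟩

theorem mul_assoc_aux (x y z : PathAlgebra k Q) : x * y * z = x * (y * z) := by
  induction x using induct with
  | h0 => simp
  | hadd x x' hx hx' => simp [add_mul, hx, hx']
  | hsmul c x hx => simp only [smul_mul_assoc, hx]
  | hpath u v p =>
  induction y using induct with
  | h0 => simp
  | hadd y y' hy hy' => simp [mul_add, add_mul, hy, hy']
  | hsmul c y hy => simp only [smul_mul_assoc, mul_smul_comm, hy]
  | hpath v' w q =>
  induction z using induct with
  | h0 => simp
  | hadd z z' hz hz' => simp [mul_add, hz, hz']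
  | hsmul c z hz => simp only [mul_smul_comm, hz]
  | hpath w' t r =>
    by_cases h : v = v'
    · subst h
      by_cases h' : w = w'
      · subst h'
        simp [ofPath_mul_ofPath, Quiver.Path.comp_assoc]
      · simp [ofPath_mul_ofPath, ofPath_mul_ofPath_of_ne _ _ h']
    · by_cases h' : w = w'
      · subst h'
        simp [ofPath_mul_ofPath, ofPath_mul_ofPath_of_ne _ _ h]
      · simp [ofPath_mul_ofPath_of_ne _ _ h, ofPath_mul_ofPath_of_ne _ _ h']

variable [Fintype Q]

/-- The unit of the path algebra is the sum of the trivial paths. -/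
instance : One (PathAlgebra k Q) := ⟨∑ v : Q, ofPath k (Quiver.Path.nil : Quiver.Path v v)⟩

theorem one_def :
    (1 : PathAlgebra k Q) = ∑ v : Q, ofPath k (Quiver.Path.nil : Quiver.Path v v) := rfl

theorem one_mul_aux (x : PathAlgebra k Q) : 1 * x = x := by
  induction x using induct with
  | h0 => simp
  | hadd x x' hx hx' => simp [mul_add, hx, hx']
  | hsmul c x hx => simp only [mul_smul_comm, hx]
  | hpath u v p =>
    rw [one_def, Finset.sum_mul, Finset.sum_eq_single u]
    · simp [ofPath_mul_ofPath]
    · intro w _ hw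
      exact ofPath_mul_ofPath_of_ne _ _ hw
    · simp

theorem mul_one_aux (x : PathAlgebra k Q) : x * 1 = x := by
  induction x using induct with
  | h0 => simp
  | hadd x x' hx hx' => simp [add_mul, hx, hx']
  | hsmul c x hx => simp only [smul_mul_assoc, hx]
  | hpath u v p =>
    rw [one_def, Finset.mul_sum, Finset.sum_eq_single v]
    · simp [ofPath_mul_ofPath]
    · intro w _ hw
      exact ofPath_mul_ofPath_of_ne _ _ hw.symm
    · simp

instance : Ring (PathAlgebra k Q) where
  __ := (inferInstance : NonUnitalNonAssocRing (PathAlgebra k Q))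
  mul_assoc := mul_assoc_aux
  one := 1
  one_mul := one_mul_aux
  mul_one := mul_one_aux

instance : Algebra k (PathAlgebra k Q) :=
  Algebra.ofModule (fun c x y => smul_mul_assoc c x y) (fun c x y => mul_smul_comm c x y)

variable (k Q)

/-- The two-sided ideal of the path algebra generated by the arrows. -/
def arrowIdeal : Ideal (PathAlgebra k Q) :=
  TwoSidedIdeal.asIdeal (TwoSidedIdeal.span
    {x | ∃ (u v : Q) (a : u ⟶ v), x = ofPath k a.toPath})

variable {k Q}

/-- An ideal `I` of the path algebra is admissible if it lies between the square of the arrow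
ideal and some power `J ^ l`, `l ≥ 2`, of the arrow ideal `J`. -/
def IsAdmissible (I : Ideal (PathAlgebra k Q)) : Prop :=
  I ≤ arrowIdeal k Q ^ 2 ∧ ∃ l : ℕ, 2 ≤ l ∧ arrowIdeal k Q ^ l ≤ I

end Basic

end PathAlgebra

/-! ### Varieties as spaces with functions

A classical variety over `k` is a topological space together with, for every open subset `U`,
the `k`-valued functions that are regular on `U`. -/

/-- A topological space together with a notion of `k`-valued functions regular on its open
subsets. (A function regular on `U` is given by any extension of it to the whole space.) -/
structure SpaceWithFunctions (k : Type*) where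
  /-- the points -/
  carrier : Type*
  /-- the topology -/
  top : TopologicalSpace carrier
  /-- `IsRegular U f` says that the restriction of `f` to the open set `U` is regular -/
  IsRegular : Set carrier → (carrier → k) → Prop

namespace SpaceWithFunctions

/-- An isomorphism of spaces with functions: a homeomorphism that identifies the regular
functions on corresponding open subsets. -/
structure Iso {k : Type*} (X Y : SpaceWithFunctions k) where
  /-- the underlying bijection -/
  toEquiv : X.carrier ≃ Y.carrier
  isOpen_iff : ∀ U : Set Y.carrier, Y.top.IsOpen U ↔ X.top.IsOpen (toEquiv ⁻¹' U)
  isRegular_iff : ∀ (U : Set Y.carrier) (f : Y.carrier → k), Y.top.IsOpen U →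
    (Y.IsRegular U f ↔ X.IsRegular (toEquiv ⁻¹' U) (f ∘ toEquiv))

/-- A subset `S` of `X`, with the subspace topology; its regular functions are those that are
locally restrictions of regular functions on open subsets of `X`. -/
def sub {k : Type*} (X : SpaceWithFunctions k) (S : Set X.carrier) : SpaceWithFunctions k where
  carrier := S
  top := X.top.induced Subtype.val
  IsRegular U f := ∀ x ∈ U, ∃ (O : Set X.carrier) (g : X.carrier → k),
    X.top.IsOpen O ∧ (x : X.carrier) ∈ O ∧ X.IsRegular O g ∧
      ∀ y ∈ U, (y : X.carrier) ∈ O → f y = g y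

/-- The quotient of `X` along a map `π`: a set is open, and a function is regular on it, when
the pullback along `π` is. -/
def quot {k : Type*} (X : SpaceWithFunctions k) {Y : Type*} (π : X.carrier → Y) :
    SpaceWithFunctions k where
  carrier := Y
  top := X.top.coinduced π
  IsRegular U f := X.IsRegular (π ⁻¹' U) (f ∘ π)

end SpaceWithFunctions

/-- The polynomial functions on a vector space: the algebra generated by the linear forms. -/
def polyFun (k W : Type*) [Field k] [AddCommGroup W] [Module k W] : Subalgebra k (W → k) :=
  Algebra.adjoin k (Set.range fun φ : W →ₗ[k] k => (φ : W → k))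

/-- A finite-dimensional vector space as an affine space: the Zariski topology, whose basic open
sets are the nonvanishing loci of polynomial functions, and the functions that are locally
quotients of polynomial functions. -/
def affineSpace (k W : Type*) [Field k] [AddCommGroup W] [Module k W] : SpaceWithFunctions k where
  carrier := W
  top := TopologicalSpace.generateFrom {U | ∃ p ∈ polyFun k W, U = {w | p w ≠ 0}}
  IsRegular U f := ∀ x ∈ U, ∃ p ∈ polyFun k W, ∃ q ∈ polyFun k W,
    q x ≠ 0 ∧ ∀ y ∈ U, q y ≠ 0 → f y = p y / q y

/-- The variety of frames: linearly independent `m`-tuples of vectors of `V`, i.e. injective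
linear maps from `k ^ m` to `V`. -/
def frameSpace (k V : Type*) [Field k] [AddCommGroup V] [Module k V] (m : ℕ) :
    SpaceWithFunctions k :=
  (affineSpace k (Fin m → V)).sub {F : Fin m → V | LinearIndependent k F}

/-- The subspace spanned by a frame. -/
def frameSpan (k V : Type*) [Field k] [AddCommGroup V] [Module k V] (m : ℕ)
    (F : {F : Fin m → V // LinearIndependent k F}) :
    {W : Submodule k V // Module.finrank k W = m} :=
  ⟨Submodule.span k (Set.range F.1), by simpa using finrank_span_eq_card F.2⟩

/-- The Grassmannian of `m`-dimensional subspaces of `V`, as the geometric quotient of the variety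
of frames by the change of frames: two frames have the same image exactly when they span the
same subspace. -/
def grassmannian (k V : Type*) [Field k] [AddCommGroup V] [Module k V] (m : ℕ) :
    SpaceWithFunctions k :=
  (frameSpace k V m).quot (frameSpan k V m)

/-- The variety of `m`-dimensional (unital) subalgebras of `B`, as a subvariety of the
Grassmannian of `m`-dimensional subspaces of `B`. -/
def algGr (k B : Type*) [Field k] [Ring B] [Algebra k B] (m : ℕ) : SpaceWithFunctions k :=
  (grassmannian k B m).sub
    {W : {W : Submodule k B // Module.finrank k W = m} |
      ∃ A : Subalgebra k B, Subalgebra.toSubmodule A = W.1}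

/-- The subspace of `B` underlying a point of the variety of subalgebras. -/
def algGr.space {k B : Type*} [Field k] [Ring B] [Algebra k B] {m : ℕ}
    (A : (algGr k B m).carrier) : Submodule k B :=
  A.1.1

end

/-! ### Subalgebras and the filtration by powers of a nilpotent ideal -/

section Filtration

/-! Let `A` have codimension `r` in `B` and let `J` be a nilpotent two-sided ideal. Call `i` a jump
if `J ^ i` is not contained in `A + J ^ (i + 1)`. The chain `A + J ^ i` loses dimension at each
jump, so there are at most `r` jumps (`card_le_of_not_le`). Non-jumps are closed under addition
because `A` is a subalgebra (`idealPow_add_le`). If some `i ≥ 2r` were a jump, then for each `1 ≤ a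
≤ r` one of `a`, `i - a` would be a jump too; with `i` this makes `r + 1` jumps. So there are no
jumps from `2r` on, and nilpotency gives `J ^ (2r) ⊆ A` (`idealPow_le_subalgebra`).

Image and preimage under `B → B / J ^ (2r)` are therefore inverse bijections between the subalgebras
in question. Both are morphisms because they lift locally to polynomial maps of frames: preimages by
adjoining a basis of the kernel (`isLocallyPoly_comap`), images by intersecting with a complement of
the kernel and solving by Cramer's rule (`isLocallyPoly_map_inf_ker`).

For part (2), take `r = 1`. Powers of the arrow ideal are spans of long paths
(`mem_arrowIdeal_pow_iff`), and the radical of `kQ/I` is the image of the arrow ideal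
(`mk_mem_jacobson_iff`). Hence the quotient by the radical square is `kQ/J(Q)²`, which does not
involve `I`. -/

theorem card_filter_lt_add_le (d : ℕ → ℕ) (hd : Antitone d) (N : ℕ) :
    ((Finset.range N).filter fun i => d (i + 1) < d i).card + d N ≤ d 0 := by
  induction N with
  | zero => simp
  | succ N ih =>
    rw [Finset.range_add_one, Finset.filter_insert]
    have := hd (Nat.le_succ N)
    split_ifs with h
    · rw [Finset.card_insert_of_notMem (by simp)]
      simp only [Nat.succ_eq_add_one] at this
      omega
    · simp only [Nat.succ_eq_add_one] at this
      omega

variable {k B : Type*} [Field k] [Ring B] [Algebra k B]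

/-- The powers of an ideal of an algebra, as subspaces. -/
def idealPow (k : Type*) {B : Type*} [Field k] [Ring B] [Algebra k B] (J : Ideal B) (i : ℕ) :
    Submodule k B :=
  (J ^ i).restrictScalars k

theorem mem_idealPow {J : Ideal B} {i : ℕ} {x : B} : x ∈ idealPow k J i ↔ x ∈ J ^ i := Iff.rfl

theorem idealPow_antitone (J : Ideal B) : Antitone (idealPow k J) :=
  fun _ _ h _ hx => Ideal.pow_le_pow_right h hx

theorem idealPow_zero (J : Ideal B) : idealPow k J 0 = ⊤ := by
  ext x; simp [mem_idealPow, Submodule.pow_zero, Ideal.one_eq_top]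

theorem idealPow_add_le (A : Subalgebra k B) (J : Ideal B) [J.IsTwoSided] {a b : ℕ}
    (ha : idealPow k J a ≤ Subalgebra.toSubmodule A ⊔ idealPow k J (a + 1))
    (hb : idealPow k J b ≤ Subalgebra.toSubmodule A ⊔ idealPow k J (b + 1)) :
    idealPow k J (a + b) ≤ Subalgebra.toSubmodule A ⊔ idealPow k J (a + b + 1) := by
  intro z hz
  rw [mem_idealPow, Ideal.IsTwoSided.pow_add] at hz
  induction hz using Submodule.mul_induction_on' with
  | add x _ y _ hx hy => exact add_mem hx hy
  | mem_mul_mem x hx y hy =>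
    obtain ⟨α, hα, x', hx', rfl⟩ := Submodule.mem_sup.1 (ha (mem_idealPow.2 hx))
    obtain ⟨β, hβ, y', hy', rfl⟩ := Submodule.mem_sup.1 (hb (mem_idealPow.2 hy))
    rw [mem_idealPow] at hx' hy'
    -- The error is `x * y' + x' * β`, whose terms lie in `J ^ a * J ^ (b + 1)` and `J ^ (a + 1) * J
    -- ^ b`.
    refine Submodule.mem_sup.2 ⟨α * β, A.mul_mem hα hβ, (α + x') * y' + x' * β, ?_, by noncomm_ring⟩
    have hβ' : β ∈ J ^ b := by
      simpa using sub_mem hy (Ideal.pow_le_pow_right b.le_succ hy')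
    refine add_mem ?_ ?_
    · have := Ideal.mul_mem_mul hx hy'
      rwa [← Ideal.IsTwoSided.pow_add, ← add_assoc] at this
    · have := Ideal.mul_mem_mul hx' hβ'
      rwa [← Ideal.IsTwoSided.pow_add, add_right_comm] at this

/-- Iterating the hypothesis pushes the error term into ever higher powers of `J`, which eventually
vanish. -/
theorem idealPow_le_of_isNilpotent (J : Ideal B) (hJ : IsNilpotent J) (W : Submodule k B) (s : ℕ)
    (h : ∀ i, s ≤ i → idealPow k J i ≤ W ⊔ idealPow k J (i + 1)) : idealPow k J s ≤ W := by
  have key : ∀ t, idealPow k J s ≤ W ⊔ idealPow k J (s + t) := by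
    intro t
    induction t with
    | zero => exact le_sup_right
    | succ t ih => exact ih.trans (sup_le le_sup_left (h _ (Nat.le_add_right _ _)))
  obtain ⟨N, hN⟩ := hJ
  refine (key N).trans (sup_le le_rfl fun x hx => ?_)
  have := Ideal.pow_le_pow_right (Nat.le_add_left N s) (mem_idealPow.1 hx)
  rw [hN] at this
  simp only [Submodule.zero_eq_bot, Submodule.mem_bot] at this
  simp [this]

variable [Module.Finite k B]

/-- The chain `W + J ^ i` starts at `B`, and each index of `s` is a strict drop: equality of
consecutive terms would put `J ^ i` inside `W + J ^ (i + 1)`. -/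
theorem card_le_of_not_le (J : Ideal B) (W : Submodule k B) (s : Finset ℕ)
    (hs : ∀ i ∈ s, ¬ idealPow k J i ≤ W ⊔ idealPow k J (i + 1)) (N : ℕ) (hN : ∀ i ∈ s, i < N) :
    s.card + Module.finrank k (W ⊔ idealPow k J N : Submodule k B) ≤ Module.finrank k B := by
  have hmono : Antitone fun i => W ⊔ idealPow k J i :=
    fun i j h => sup_le_sup_left (idealPow_antitone J h) W
  have := card_filter_lt_add_le (fun i => Module.finrank k (W ⊔ idealPow k J i : Submodule k B))
    (fun i j h => Submodule.finrank_mono (hmono h)) N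
  rw [idealPow_zero, sup_top_eq, finrank_top] at this
  refine le_trans (Nat.add_le_add_right (Finset.card_le_card fun i hi => ?_) _) this
  rw [Finset.mem_filter, Finset.mem_range]
  refine ⟨hN i hi, Submodule.finrank_lt_finrank_of_lt (lt_of_le_of_ne (hmono i.le_succ) ?_)⟩
  intro h
  exact hs i hi (le_sup_right.trans h.ge)

/-- A subalgebra of codimension `r` contains the `2r`-th power of every nilpotent ideal. -/
theorem idealPow_le_subalgebra (J : Ideal B) [J.IsTwoSided] (hJ : IsNilpotent J) (A : Subalgebra k B) (r : ℕ)
    (hr : Module.finrank k A + r = Module.finrank k B) :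
    idealPow k J (2 * r) ≤ Subalgebra.toSubmodule A := by
  refine idealPow_le_of_isNilpotent J hJ _ _ fun i hi => ?_
  by_contra hbad
  classical
  let bad : ℕ → Prop := fun a =>
    ¬ idealPow k J a ≤ Subalgebra.toSubmodule A ⊔ idealPow k J (a + 1)
  have hpair : ∀ a ≤ i, ¬ bad a → bad (i - a) := by
    intro a ha h h'
    have := idealPow_add_le A J (not_not.1 h) h'
    rw [Nat.add_sub_cancel' ha] at this
    exact hbad this
  -- The `r + 1` jumps: `i` itself, and one of `a`, `i - a` for each `1 ≤ a ≤ r`. They are distinct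
  -- because `i ≥ 2r`: an equality `i - a = b` with `a, b ≤ r` forces `a = b = r`.
  let c : ℕ → ℕ := fun a => if a = 0 then i else if bad a then a else i - a
  have hc : Set.InjOn c (Finset.range (r + 1)) := by
    intro a ha b hb hab
    simp only [Finset.coe_range, Set.mem_Iio] at ha hb
    simp only [c] at hab
    split_ifs at hab <;> omega
  have h1 := card_le_of_not_le J (Subalgebra.toSubmodule A) ((Finset.range (r + 1)).image c)
    (by
      intro j hj
      obtain ⟨a, ha, rfl⟩ := Finset.mem_image.1 hj
      rw [Finset.mem_range] at ha
      simp only [c]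
      split_ifs with h0 h
      · exact hbad
      · exact h
      · exact hpair a (by omega) h) (i + 1)
    (by
      intro j hj
      obtain ⟨a, ha, rfl⟩ := Finset.mem_image.1 hj
      rw [Finset.mem_range] at ha
      simp only [c]
      split_ifs <;> omega)
  rw [Finset.card_image_of_injOn hc, Finset.card_range] at h1
  have h2 : Module.finrank k A ≤ Module.finrank k
      (Subalgebra.toSubmodule A ⊔ idealPow k J (i + 1) : Submodule k B) :=
    Submodule.finrank_mono (le_sup_left (a := Subalgebra.toSubmodule A))
  omega

/-- Take `W = 0` in the jump count. If `J ^ i ⊆ J ^ (i + 1)` for some `i < s`, multiplying by powers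
of `J` makes the chain stationary from `i` on, so nilpotency kills `J ^ i` and with it `J ^ s`. -/
theorem finrank_idealPow_add_le (J : Ideal B) [J.IsTwoSided] (hJ : IsNilpotent J) (s : ℕ)
    (hs : idealPow k J s ≠ ⊥) : s + Module.finrank k (idealPow k J s) ≤ Module.finrank k B := by
  have h := card_le_of_not_le J (⊥ : Submodule k B) (Finset.range s) (N := s) (by
    intro i hi h
    rw [Finset.mem_range] at hi
    refine hs (le_bot_iff.1 ((idealPow_antitone J hi.le).trans
      (idealPow_le_of_isNilpotent J hJ ⊥ i fun j hj => ?_)))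
    obtain ⟨t, rfl⟩ := Nat.exists_eq_add_of_le hj
    rw [bot_sup_eq] at h ⊢
    intro x hx
    rw [mem_idealPow] at hx ⊢
    have h' : J ^ i ≤ J ^ (i + 1) := h
    have h'' : J ^ (t + i) ≤ J ^ (t + (i + 1)) := by
      rw [Ideal.IsTwoSided.pow_add, Ideal.IsTwoSided.pow_add]
      exact Ideal.mul_mono_right h'
    rw [show i + t + 1 = t + (i + 1) by omega]
    exact h'' (by rwa [add_comm]))
    (by simp)
  rw [bot_sup_eq, Finset.card_range] at h
  exact h

end Filtration

/-! ### Morphisms of Grassmannians through polynomial maps of frames -/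

section Morphisms

variable {k W W' : Type*} [Field k] [AddCommGroup W] [Module k W] [AddCommGroup W'] [Module k W']

theorem linearForm_mem_polyFun (φ : W →ₗ[k] k) : (φ : W → k) ∈ polyFun k W :=
  Algebra.subset_adjoin ⟨φ, rfl⟩

/-- A polynomial map between vector spaces. -/
def IsPolyMap (k : Type*) {W W' : Type*} [Field k] [AddCommGroup W] [Module k W]
    [AddCommGroup W'] [Module k W'] (P : W → W') : Prop :=
  ∀ φ : W' →ₗ[k] k, (fun x => φ (P x)) ∈ polyFun k W

theorem IsPolyMap.comp_mem {P : W → W'} (hP : IsPolyMap k P) {g : W' → k}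
    (hg : g ∈ polyFun k W') : g ∘ P ∈ polyFun k W := by
  induction hg using Algebra.adjoin_induction with
  | mem x hx => obtain ⟨φ, rfl⟩ := hx; exact hP φ
  | algebraMap r => exact (polyFun k W).algebraMap_mem r
  | add x y _ _ hx hy => exact add_mem hx hy
  | mul x y _ _ hx hy => exact mul_mem hx hy

theorem exists_basicOpen_subset {O : Set W} (hO : (affineSpace k W).top.IsOpen O) {x : W}
    (hx : x ∈ O) : ∃ h ∈ polyFun k W, h x ≠ 0 ∧ ∀ y, h y ≠ 0 → y ∈ O := by
  change TopologicalSpace.GenerateOpen _ O at hO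
  induction hO with
  | basic s hs =>
    obtain ⟨p, hp, rfl⟩ := hs
    exact ⟨p, hp, hx, fun _ h => h⟩
  | univ => exact ⟨1, one_mem _, one_ne_zero, fun _ _ => trivial⟩
  | inter s t _ _ hs ht =>
    obtain ⟨p, hp, hpx, hps⟩ := hs hx.1
    obtain ⟨q, hq, hqx, hqt⟩ := ht hx.2
    exact ⟨p * q, mul_mem hp hq, mul_ne_zero hpx hqx, fun y hy =>
      ⟨hps y (left_ne_zero_of_mul hy), hqt y (right_ne_zero_of_mul hy)⟩⟩
  | sUnion S _ ih =>
    obtain ⟨s, hs, hxs⟩ := hx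
    obtain ⟨h, hh, hhx, H⟩ := ih s hs hxs
    exact ⟨h, hh, hhx, fun y hy => ⟨s, hs, H y hy⟩⟩

theorem isOpen_basicOpen {p : W → k} (hp : p ∈ polyFun k W) :
    (affineSpace k W).top.IsOpen {w | p w ≠ 0} :=
  TopologicalSpace.GenerateOpen.basic _ ⟨p, hp, rfl⟩

variable {V V' : Type*} [AddCommGroup V] [Module k V] [AddCommGroup V'] [Module k V'] {m m' : ℕ}

theorem frameSpace_isOpen_iff (Z : Set {F : Fin m → V // LinearIndependent k F}) :
    (frameSpace k V m).top.IsOpen Z ↔ ∀ F ∈ Z, ∃ q ∈ polyFun k (Fin m → V), q F.1 ≠ 0 ∧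
      ∀ F' : {F : Fin m → V // LinearIndependent k F}, q F'.1 ≠ 0 → F' ∈ Z := by
  constructor
  · rintro ⟨O, hO, rfl⟩ F hF
    obtain ⟨h, hh, hx, H⟩ := exists_basicOpen_subset (W := Fin m → V) hO hF
    exact ⟨h, hh, hx, fun F' hF' => H _ hF'⟩
  · intro H
    refine ⟨⋃₀ {U | (∃ p ∈ polyFun k (Fin m → V), U = {w | p w ≠ 0}) ∧
      ∀ F' : {F : Fin m → V // LinearIndependent k F}, F'.1 ∈ U → F' ∈ Z},
      TopologicalSpace.GenerateOpen.sUnion _ fun s hs =>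
        TopologicalSpace.GenerateOpen.basic _ hs.1, ?_⟩
    ext F
    constructor
    · rintro ⟨U, ⟨_, hU⟩, hF⟩
      exact hU F hF
    · intro hF
      obtain ⟨q, hq, hqF, hqZ⟩ := H F hF
      exact ⟨_, ⟨⟨q, hq, rfl⟩, hqZ⟩, hqF⟩

theorem frameSpace_isRegular_iff (Z : Set {F : Fin m → V // LinearIndependent k F})
    (f : {F : Fin m → V // LinearIndependent k F} → k) :
    (frameSpace k V m).IsRegular Z f ↔ ∀ F ∈ Z, ∃ p ∈ polyFun k (Fin m → V),
      ∃ q ∈ polyFun k (Fin m → V), q F.1 ≠ 0 ∧ ∀ F' ∈ Z, q F'.1 ≠ 0 → f F' = p F'.1 / q F'.1 := by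
  constructor
  · intro H F hF
    obtain ⟨O, g, hO, hFO, hg, hfg⟩ := H F hF
    obtain ⟨h, hh, hx, hhO⟩ := exists_basicOpen_subset (W := Fin m → V) hO hFO
    obtain ⟨p, hp, q, hq, hqF, hgpq⟩ := hg _ hFO
    -- The extra factor `h` leaves the fraction unchanged, while its nonvanishing keeps the frame
    -- inside `O`.
    refine ⟨p * h, mul_mem hp hh, q * h, mul_mem hq hh, mul_ne_zero hqF hx, fun F' hF' hne => ?_⟩
    have h1 : q F'.1 ≠ 0 := left_ne_zero_of_mul hne
    have h2 : h F'.1 ≠ 0 := right_ne_zero_of_mul hne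
    rw [hfg F' hF' (hhO _ h2), hgpq _ (hhO _ h2) h1]
    exact (mul_div_mul_right _ _ h2).symm
  · intro H F hF
    obtain ⟨p, hp, q, hq, hqF, hf⟩ := H F hF
    exact ⟨{w | q w ≠ 0}, fun w => p w / q w, isOpen_basicOpen hq, hqF,
      fun x hx => ⟨p, hp, q, hq, hx, fun _ _ _ => rfl⟩, fun y hy hyO => hf y hy hyO⟩

/-- The points of the Grassmannian. -/
abbrev SubspaceOfDim (k V : Type*) [Field k] [AddCommGroup V] [Module k V] (m : ℕ) : Type _ :=
  {W : Submodule k V // Module.finrank k W = m}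

theorem grassmannian_isOpen_iff (U : Set (SubspaceOfDim k V m)) :
    (grassmannian k V m).top.IsOpen U ↔
      ∀ F : {F : Fin m → V // LinearIndependent k F}, frameSpan k V m F ∈ U →
        ∃ q ∈ polyFun k (Fin m → V), q F.1 ≠ 0 ∧
          ∀ F' : {F : Fin m → V // LinearIndependent k F}, q F'.1 ≠ 0 → frameSpan k V m F' ∈ U :=
  frameSpace_isOpen_iff (frameSpan k V m ⁻¹' U)

theorem grassmannian_isRegular_iff (U : Set (SubspaceOfDim k V m)) (f : SubspaceOfDim k V m → k) :
    (grassmannian k V m).IsRegular U f ↔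
      ∀ F : {F : Fin m → V // LinearIndependent k F}, frameSpan k V m F ∈ U →
        ∃ p ∈ polyFun k (Fin m → V), ∃ q ∈ polyFun k (Fin m → V), q F.1 ≠ 0 ∧
          ∀ F' : {F : Fin m → V // LinearIndependent k F}, frameSpan k V m F' ∈ U → q F'.1 ≠ 0 →
            f (frameSpan k V m F') = p F'.1 / q F'.1 :=
  frameSpace_isRegular_iff (frameSpan k V m ⁻¹' U) (f ∘ frameSpan k V m)

/-- An operation `φ` on subspaces that, on the open subset `O` of the Grassmannian, is locally
given by polynomial maps between spaces of frames. -/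
def IsLocallyPoly (m m' : ℕ) (O : Set (Submodule k V))
    (φ : Submodule k V → Submodule k V') : Prop :=
  ∀ F : Fin m → V, LinearIndependent k F → Submodule.span k (Set.range F) ∈ O →
    ∃ (P : (Fin m → V) → (Fin m' → V')) (q : (Fin m → V) → k), IsPolyMap k P ∧
      q ∈ polyFun k (Fin m → V) ∧ q F ≠ 0 ∧ ∀ F' : Fin m → V, LinearIndependent k F' → q F' ≠ 0 →
        Submodule.span k (Set.range F') ∈ O ∧ LinearIndependent k (P F') ∧
          Submodule.span k (Set.range (P F')) = φ (Submodule.span k (Set.range F'))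

variable {O : Set (Submodule k V)} {φ : Submodule k V → Submodule k V'}

/-- The subset of `O` of all subspaces that `φ` maps into `U`. -/
def grPreimage (m : ℕ) {m' : ℕ} (O : Set (Submodule k V)) (φ : Submodule k V → Submodule k V')
    (U : Set (SubspaceOfDim k V' m')) : Set (SubspaceOfDim k V m) :=
  {X | X.1 ∈ O ∧ ∃ h : Module.finrank k (φ X.1) = m', (⟨φ X.1, h⟩ : SubspaceOfDim k V' m') ∈ U}

theorem IsLocallyPoly.isOpen_preimage (hφ : IsLocallyPoly m m' O φ)
    (U : Set (SubspaceOfDim k V' m')) (hU : (grassmannian k V' m').top.IsOpen U) :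
    (grassmannian k V m).top.IsOpen (grPreimage m O φ U) := by
  rw [grassmannian_isOpen_iff] at hU ⊢
  rintro F ⟨hFO, h, hFU⟩
  obtain ⟨P, q, hP, hq, hqF, H⟩ := hφ F.1 F.2 hFO
  have key : ∀ (F' : {F : Fin m → V // LinearIndependent k F}) (hF' : q F'.1 ≠ 0)
      (h' : Module.finrank k (φ (Submodule.span k (Set.range F'.1))) = m'),
      frameSpan k V' m' ⟨P F'.1, (H F'.1 F'.2 hF').2.1⟩ =
        ⟨φ (Submodule.span k (Set.range F'.1)), h'⟩ :=
    fun F' hF' h' => Subtype.ext (H F'.1 F'.2 hF').2.2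
  obtain ⟨q', hq', hq'F, H'⟩ := hU ⟨P F.1, (H F.1 F.2 hqF).2.1⟩ (by
    rw [key F hqF h]; exact hFU)
  -- Nonvanishing of `q` ensures that `P` computes `φ`; nonvanishing of `q' ∘ P` ensures that the
  -- image lies in `U`.
  refine ⟨q * (q' ∘ P), mul_mem hq (hP.comp_mem hq'), mul_ne_zero hqF hq'F, fun F' hF' => ?_⟩
  have h1 : q F'.1 ≠ 0 := left_ne_zero_of_mul hF'
  have h2 : q' (P F'.1) ≠ 0 := right_ne_zero_of_mul hF'
  have h3 : Module.finrank k (φ (Submodule.span k (Set.range F'.1))) = m' := by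
    rw [← (H F'.1 F'.2 h1).2.2, finrank_span_eq_card (H F'.1 F'.2 h1).2.1, Fintype.card_fin]
  refine ⟨(H F'.1 F'.2 h1).1, h3, ?_⟩
  have := H' ⟨P F'.1, (H F'.1 F'.2 h1).2.1⟩ h2
  rw [key F' h1 h3] at this
  exact this

-- The value `0` in the wrong dimension only makes the function total; it is never taken on
-- `grPreimage m O φ U`.
open Classical in
theorem IsLocallyPoly.isRegular_comp (hφ : IsLocallyPoly m m' O φ)
    (U : Set (SubspaceOfDim k V' m')) (g : SubspaceOfDim k V' m' → k)
    (hg : (grassmannian k V' m').IsRegular U g) :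
    (grassmannian k V m).IsRegular (grPreimage m O φ U) fun X =>
      if h : Module.finrank k (φ X.1) = m' then g ⟨φ X.1, h⟩ else 0 := by
  rw [grassmannian_isRegular_iff] at hg
  refine (grassmannian_isRegular_iff _ _).2 ?_
  rintro F ⟨hFO, h, hFU⟩
  obtain ⟨P, q, hP, hq, hqF, H⟩ := hφ F.1 F.2 hFO
  have key : ∀ (F' : {F : Fin m → V // LinearIndependent k F}) (hF' : q F'.1 ≠ 0)
      (h' : Module.finrank k (φ (Submodule.span k (Set.range F'.1))) = m'),
      frameSpan k V' m' ⟨P F'.1, (H F'.1 F'.2 hF').2.1⟩ =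
        ⟨φ (Submodule.span k (Set.range F'.1)), h'⟩ :=
    fun F' hF' h' => Subtype.ext (H F'.1 F'.2 hF').2.2
  obtain ⟨a, ha, b, hb, hbF, H'⟩ := hg ⟨P F.1, (H F.1 F.2 hqF).2.1⟩ (by
    rw [key F hqF h]; exact hFU)
  refine ⟨(a ∘ P) * q, mul_mem (hP.comp_mem ha) hq, (b ∘ P) * q, mul_mem (hP.comp_mem hb) hq,
    mul_ne_zero hbF hqF, ?_⟩
  rintro F' ⟨hF'O, h', hF'U⟩ hF'
  have h1 : q F'.1 ≠ 0 := right_ne_zero_of_mul hF'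
  have h2 : b (P F'.1) ≠ 0 := left_ne_zero_of_mul hF'
  have := H' ⟨P F'.1, (H F'.1 F'.2 h1).2.1⟩ (by
    rw [key F' h1 h']; exact hF'U) h2
  rw [key F' h1 h'] at this
  refine (dif_pos h').trans (this.trans ?_)
  exact (mul_div_mul_right _ _ h1).symm

/-- The conditions on a map of spaces with functions to be a morphism. -/
structure SpaceWithFunctions.IsMorphism {k : Type*} (X Y : SpaceWithFunctions k)
    (f : X.carrier → Y.carrier) : Prop where
  isOpen_preimage : ∀ U, Y.top.IsOpen U → X.top.IsOpen (f ⁻¹' U)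
  isRegular_comp : ∀ U g, Y.top.IsOpen U → Y.IsRegular U g → X.IsRegular (f ⁻¹' U) (g ∘ f)

/-- Mutually inverse morphisms form an isomorphism. -/
def SpaceWithFunctions.Iso.ofIsMorphism {k : Type*} {X Y : SpaceWithFunctions k}
    (e : X.carrier ≃ Y.carrier) (h : IsMorphism X Y e) (h' : IsMorphism Y X e.symm) :
    Iso X Y where
  toEquiv := e
  isOpen_iff U := ⟨h.isOpen_preimage U, fun hU => by
    simpa [← Set.preimage_comp] using h'.isOpen_preimage _ hU⟩
  isRegular_iff U f hU := ⟨h.isRegular_comp U f hU, fun hf => by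
    simpa [← Set.preimage_comp, Function.comp_assoc] using
      h'.isRegular_comp _ _ (h.isOpen_preimage U hU) hf⟩

/-- The inverse of an isomorphism. -/
def SpaceWithFunctions.Iso.symm {k : Type*} {X Y : SpaceWithFunctions k} (e : Iso X Y) :
    Iso Y X where
  toEquiv := e.toEquiv.symm
  isOpen_iff U := by
    rw [e.isOpen_iff, ← Set.preimage_comp, Equiv.symm_comp_self, Set.preimage_id]
  isRegular_iff U f hU := by
    have h : e.toEquiv ⁻¹' (e.toEquiv.symm ⁻¹' U) = U := by
      rw [← Set.preimage_comp, Equiv.symm_comp_self, Set.preimage_id]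
    rw [e.isRegular_iff _ _ ((e.isOpen_iff _).2 (h.symm ▸ hU)), h, Function.comp_assoc,
      Equiv.symm_comp_self, Function.comp_id]

/-- The composite of two isomorphisms. -/
def SpaceWithFunctions.Iso.trans {k : Type*} {X Y Z : SpaceWithFunctions k} (e : Iso X Y)
    (e' : Iso Y Z) : Iso X Z where
  toEquiv := e.toEquiv.trans e'.toEquiv
  isOpen_iff U := (e'.isOpen_iff U).trans (e.isOpen_iff _)
  isRegular_iff U f hU :=
    (e'.isRegular_iff U f hU).trans (e.isRegular_iff _ _ ((e'.isOpen_iff U).1 hU))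

/-- Only the agreement of `e` with `φ` on `S` matters, so `φ` may be any convenient formula that is
right on `S` alone. This allows `W ↦ f (W ∩ ker p)` to stand in for `W ↦ f W`. -/
theorem IsLocallyPoly.isMorphism (hφ : IsLocallyPoly m m' O φ)
    (S : Set (SubspaceOfDim k V m)) (S' : Set (SubspaceOfDim k V' m'))
    (hS : ∀ X ∈ S, X.1 ∈ O) (e : S → S') (he : ∀ X : S, (e X).1.1 = φ X.1.1) :
    SpaceWithFunctions.IsMorphism ((grassmannian k V m).sub S) ((grassmannian k V' m').sub S')
      e := by
  have hfin : ∀ X : S, Module.finrank k (φ X.1.1) = m' := fun X => he X ▸ (e X).1.2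
  have heq : ∀ X : S, (⟨φ X.1.1, hfin X⟩ : {Y : Submodule k V' // Module.finrank k Y = m'}) =
    (e X).1 := fun X => Subtype.ext (he X).symm
  have hpre : ∀ (U : Set (SubspaceOfDim k V' m')) (X : S),
      X.1 ∈ grPreimage m O φ U ↔ (e X).1 ∈ U := by
    intro U X
    rw [← heq X]
    exact ⟨fun h => h.2.2, fun h => ⟨hS _ X.2, hfin X, h⟩⟩
  constructor
  · rintro _ ⟨U, hU, rfl⟩
    refine ⟨_, hφ.isOpen_preimage U hU, ?_⟩
    ext X
    exact hpre U X
  · intro U g hU hg X hX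
    obtain ⟨U₀, g₀, hU₀, hXU, hg₀, H⟩ := hg (e X) hX
    refine ⟨_, _, hφ.isOpen_preimage U₀ hU₀, (hpre U₀ X).2 hXU, hφ.isRegular_comp U₀ g₀ hg₀, ?_⟩
    intro Y hY hYU
    refine (H (e Y) hY ((hpre U₀ Y).1 hYU)).trans ?_
    rw [← heq Y]
    exact (dif_pos (c := Module.finrank k (φ Y.1.1) = m') (t := fun h => g₀ ⟨φ Y.1.1, h⟩)
      (hfin Y)).symm

end Morphisms

/-! ### Images and preimages of subspaces in terms of frames -/

section Frames

/-- A matrix of functions in `S` is a matrix over the commutative ring `S`; evaluation at a point is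
a ring homomorphism and commutes with determinants. -/
theorem Subalgebra.det_mem {X k n : Type*} [CommRing k] [Fintype n] [DecidableEq n]
    (S : Subalgebra k (X → k)) (M : X → Matrix n n k) (hM : ∀ i j, (fun x => M x i j) ∈ S) :
    (fun x => (M x).det) ∈ S := by
  let N : Matrix n n S := Matrix.of fun i j => ⟨fun x => M x i j, hM i j⟩
  have h : (fun x => (M x).det) = (N.det : X → k) := by
    funext x
    exact (RingHom.map_det ((Pi.evalRingHom (fun _ : X => k) x).comp S.val.toRingHom) N).symm
  rw [h]
  exact N.det.2

theorem Subalgebra.adjugate_mem {X k n : Type*} [CommRing k] [Fintype n] [DecidableEq n]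
    (S : Subalgebra k (X → k)) (M : X → Matrix n n k) (hM : ∀ i j, (fun x => M x i j) ∈ S)
    (i j : n) : (fun x => (M x).adjugate i j) ∈ S := by
  let N : Matrix n n S := Matrix.of fun i j => ⟨fun x => M x i j, hM i j⟩
  have h : (fun x => (M x).adjugate i j) = (N.adjugate i j : X → k) := by
    funext x
    exact (congr_fun₂ (RingHom.map_adjugate
      ((Pi.evalRingHom (fun _ : X => k) x).comp S.val.toRingHom) N) i j).symm
  rw [h]
  exact (N.adjugate i j).2

variable {k V V' : Type*} [Field k] [AddCommGroup V] [Module k V] [AddCommGroup V'] [Module k V']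
  {d m m' : ℕ}

theorem isPolyMap_pi {W : Type*} [AddCommGroup W] [Module k W] {P : W → Fin m → V}
    (h : ∀ t (ψ : V →ₗ[k] k), (fun x => ψ (P x t)) ∈ polyFun k W) : IsPolyMap k P := by
  intro φ
  have : (fun x => φ (P x)) = ∑ t, fun x => (φ ∘ₗ LinearMap.single k (fun _ => V) t) (P x t) := by
    funext x
    rw [Finset.sum_apply]
    conv_lhs => rw [← LinearMap.sum_single_apply (fun _ => V) (P x), map_sum]
    rfl
  rw [this]
  exact sum_mem fun t _ => h t _

theorem apply_coord_mem_polyFun (ψ : V →ₗ[k] k) (i : Fin m) :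
    (fun F : Fin m → V => ψ (F i)) ∈ polyFun k (Fin m → V) :=
  linearForm_mem_polyFun (ψ ∘ₗ LinearMap.proj (φ := fun _ : Fin m => V) i)

theorem apply_linearCombination_mem_polyFun (ψ : V →ₗ[k] k) (c : Fin m → k) :
    (fun F : Fin m → V => ψ (Fintype.linearCombination k F c)) ∈ polyFun k (Fin m → V) := by
  have : (fun F : Fin m → V => ψ (Fintype.linearCombination k F c)) =
      ∑ i, c i • fun F : Fin m → V => ψ (F i) := by
    funext F
    simp [Fintype.linearCombination_apply]
  rw [this]
  exact sum_mem fun i _ => Subalgebra.smul_mem _ (apply_coord_mem_polyFun ψ i) _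

/-- The preimage of a subspace under a surjection, in terms of frames. -/
theorem isLocallyPoly_comap (f : V →ₗ[k] V') (s : V' →ₗ[k] V) (hs : f ∘ₗ s = LinearMap.id)
    (ι : (Fin d → k) →ₗ[k] V) (hι : LinearMap.ker ι = ⊥) (hιf : LinearMap.range ι = LinearMap.ker f)
    (hm : m = d + m') : IsLocallyPoly m' m Set.univ (Submodule.comap f) := by
  subst hm
  intro F hF _
  have hfs : ∀ x, f (s x) = x := fun x => LinearMap.congr_fun hs x
  -- A fixed basis of `ker f`, followed by the lifts of the given frame along the section `s`. This
  -- works globally, so the denominator is `1`.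
  refine ⟨fun F => Sum.elim (fun j => ι (Pi.single j 1)) (fun t => s (F t)) ∘ finSumFinEquiv.symm,
    1, ?_, one_mem _, one_ne_zero, fun F' hF' _ => ⟨trivial, ?_, ?_⟩⟩
  · refine isPolyMap_pi fun t ψ => ?_
    obtain ⟨t, rfl⟩ := finSumFinEquiv.surjective t
    simp only [Function.comp_apply, Equiv.symm_apply_apply]
    cases t with
    | inl j => exact (polyFun k (Fin m' → V')).algebraMap_mem (ψ (ι (Pi.single j 1)))
    | inr t => exact apply_coord_mem_polyFun (ψ ∘ₗ s) t
  all_goals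
    have h1 : Submodule.span k (Set.range fun j : Fin d => ι (Pi.single j 1)) =
        LinearMap.ker f := by
      rw [← hιf, LinearMap.range_eq_map, ← (Pi.basisFun k (Fin d)).span_eq, Submodule.map_span,
        ← Set.range_comp]
      congr 2
      funext j
      simp
    have h2 : Submodule.span k (Set.range fun t : Fin m' => s (F' t)) =
        (Submodule.span k (Set.range F')).map s := by
      rw [Submodule.map_span, ← Set.range_comp]
      rfl
  · refine LinearIndependent.comp ?_ _ finSumFinEquiv.symm.injective
    refine LinearIndependent.sum_type ?_ ?_ ?_
    · have := (Pi.basisFun k (Fin d)).linearIndependent.map' ι hι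
      convert this using 1
      funext j
      simp
    · exact hF'.map' s (LinearMap.ker_eq_bot_of_inverse hs)
    · rw [h1, h2, Submodule.disjoint_def]
      rintro _ hx ⟨y, _, rfl⟩
      rw [LinearMap.mem_ker, hfs] at hx
      rw [hx, map_zero]
  · rw [EquivLike.range_comp, Set.Sum.elim_range, Submodule.span_union, h1, h2]
    refine le_antisymm (sup_le (fun x hx => ?_) ?_) fun x hx => ?_
    · rw [Submodule.mem_comap, LinearMap.mem_ker.1 hx]
      exact zero_mem _
    · rintro _ ⟨y, hy, rfl⟩
      rw [Submodule.mem_comap, hfs]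
      exact hy
    · refine Submodule.mem_sup.2 ⟨x - s (f x), ?_, s (f x), ⟨f x, hx, rfl⟩, by abel⟩
      rw [LinearMap.mem_ker, map_sub, hfs, sub_self]

/-- The image of the intersection with a complement `ker p` of `ker f`, in terms of frames. -/
theorem isLocallyPoly_map_inf_ker (f : V →ₗ[k] V') (p : V →ₗ[k] Fin d → k)
    (hfp : LinearMap.ker f ⊓ LinearMap.ker p = ⊥) (hm : m = d + m') :
    IsLocallyPoly m m' {W | W.map p = ⊤} fun W => (W ⊓ LinearMap.ker p).map f := by
  intro F₀ _ hO
  let L : (Fin m → V) → (Fin m → k) →ₗ[k] V := fun F => Fintype.linearCombination k F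
  have hL : ∀ F, LinearMap.range (L F) = Submodule.span k (Set.range F) :=
    fun F => Fintype.range_linearCombination k F
  have hsurj : ∀ F, (Submodule.span k (Set.range F)).map p = ⊤ ↔ LinearMap.range (p ∘ₗ L F) = ⊤ :=
    fun F => by rw [LinearMap.range_comp, hL]
  have hker : ∀ F, LinearMap.range (p ∘ₗ L F) = ⊤ →
      Module.finrank k (LinearMap.ker (p ∘ₗ L F)) = m' := by
    intro F h
    have := LinearMap.finrank_range_add_finrank_ker (p ∘ₗ L F)
    rw [h, finrank_top, Module.finrank_fin_fun, Module.finrank_fin_fun] at this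
    omega
  have h0 := (hsurj F₀).1 hO
  -- At the base frame, `α` splits `p ∘ L F₀` and `β` below parametrizes its kernel; both then stay
  -- fixed while `F` varies.
  obtain ⟨α, hα⟩ := LinearMap.exists_rightInverse_of_surjective _ h0
  let β₀ : (Fin m' → k) ≃ₗ[k] LinearMap.ker (p ∘ₗ L F₀) :=
    LinearEquiv.ofFinrankEq _ _ (by rw [hker F₀ h0, Module.finrank_fin_fun])
  let β : (Fin m' → k) →ₗ[k] (Fin m → k) := (LinearMap.ker (p ∘ₗ L F₀)).subtype ∘ₗ β₀
  have hβ : ∀ c, (p ∘ₗ L F₀) (β c) = 0 := fun c => (β₀ c).2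
  have hβ' : ∀ c, β c = 0 → c = 0 := fun c hc => by
    have : β₀ c = 0 := Subtype.ext hc
    simpa using this
  -- `M F` is the matrix of `p ∘ L F ∘ α`, the identity at `F₀`. Where it is invertible, `β - α M⁻¹
  -- (p ∘ L F) β` maps into `ker (p ∘ L F)`; multiplying by `det M` gives `γ`, which is polynomial
  -- in `F`.
  let M : (Fin m → V) → Matrix (Fin d) (Fin d) k := fun F => LinearMap.toMatrix' (p ∘ₗ L F ∘ₗ α)
  let γ : (Fin m → V) → (Fin m' → k) →ₗ[k] (Fin m → k) := fun F =>
    (M F).det • β - α ∘ₗ (M F).adjugate.mulVecLin ∘ₗ p ∘ₗ L F ∘ₗ β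
  have hM : ∀ F x, p (L F (α x)) = (M F).mulVec x := fun F x =>
    (LinearMap.toMatrix'_mulVec (p ∘ₗ L F ∘ₗ α) x).symm
  have hpγ : ∀ F c, p (L F (γ F c)) = 0 := by
    intro F c
    simp only [γ, LinearMap.sub_apply, LinearMap.smul_apply, LinearMap.comp_apply, map_sub,
      map_smul, hM, Matrix.mulVecLin_apply, Matrix.mulVec_mulVec, Matrix.mul_adjugate]
    simp [Matrix.smul_mulVec]
  have hγ : ∀ F, (M F).det ≠ 0 → ∀ c, γ F c = 0 → c = 0 := by
    intro F hF c hc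
    have h1 : (M F).adjugate.mulVecLin (p (L F (β c))) = 0 := by
      -- Applying `p ∘ L F₀` kills the `β` term and cancels `α`, so both terms of `γ F c` vanish
      -- separately.
      have := congr_arg (p ∘ₗ L F₀) hc
      simp only [γ, LinearMap.sub_apply, LinearMap.smul_apply, map_sub, map_smul, hβ,
        smul_zero, zero_sub, map_zero, neg_eq_zero] at this
      exact (LinearMap.congr_fun hα _).symm.trans this
    have h2 : (M F).det • β c = 0 := by
      have : γ F c = (M F).det • β c - α ((M F).adjugate.mulVecLin (p (L F (β c)))) := rfl
      rwa [h1, map_zero, sub_zero, hc, eq_comm] at this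
    exact hβ' c ((smul_eq_zero.1 h2).resolve_left hF)
  have hMpoly : ∀ i j, (fun F => M F i j) ∈ polyFun k (Fin m → V) := by
    intro i j
    have : (fun F => M F i j) = fun F : Fin m → V => (LinearMap.proj i ∘ₗ p : V →ₗ[k] k)
        (Fintype.linearCombination k F (α (Pi.single j 1))) := by
      funext F
      simp only [M, LinearMap.toMatrix'_apply]
      rfl
    rw [this]
    exact apply_linearCombination_mem_polyFun _ _
  have hdet : (fun F => (M F).det) ∈ polyFun k (Fin m → V) := Subalgebra.det_mem _ M hMpoly
  refine ⟨fun F t => f (L F (γ F (Pi.single t 1))), fun F => (M F).det, ?_, hdet, ?_, ?_⟩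
  · refine isPolyMap_pi fun t ψ => ?_
    have hcoord : ∀ i, (fun F => γ F (Pi.single t 1) i) ∈ polyFun k (Fin m → V) := by
      intro i
      have : (fun F => γ F (Pi.single t 1) i) = 
          (fun F => (M F).det) * algebraMap k _ (β (Pi.single t 1) i) - ∑ j, (∑ l, (fun F => (M F).adjugate j l) * fun F : Fin m → V =>
            (LinearMap.proj l ∘ₗ p : V →ₗ[k] k) (Fintype.linearCombination k F (β (Pi.single t 1)))) *
            algebraMap k _ (α (Pi.single j 1) i) := by
        funext F
        have hα' : ∀ x, α x i = ∑ j, x j * α (Pi.single j 1) i := by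
          intro x
          conv_lhs => rw [← (Pi.basisFun k (Fin d)).sum_repr x]
          simp
        have hγ' : γ F (Pi.single t 1) i = (M F).det * β (Pi.single t 1) i -
          α ((M F).adjugate.mulVec (p (L F (β (Pi.single t 1))))) i := rfl
        rw [hγ', hα']
        simp only [Pi.sub_apply, Finset.sum_apply, Pi.mul_apply, Matrix.mulVec, dotProduct]
        rfl
      rw [this]
      exact sub_mem (mul_mem hdet (Subalgebra.algebraMap_mem _ _)) (sum_mem fun j _ => mul_mem
        (sum_mem fun l _ => mul_mem (Subalgebra.adjugate_mem _ M hMpoly j l)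
          (apply_linearCombination_mem_polyFun _ _)) (Subalgebra.algebraMap_mem _ _))
    have : (fun F => ψ (f (L F (γ F (Pi.single t 1))))) =
        ∑ i, (fun F => γ F (Pi.single t 1) i) * fun F : Fin m → V => (ψ ∘ₗ f) (F i) := by
      funext F
      simp [L, Fintype.linearCombination_apply, Finset.sum_apply]
    rw [this]
    exact sum_mem fun i _ => mul_mem (hcoord i) (apply_coord_mem_polyFun _ i)
  · have : M F₀ = 1 := by
      rw [← LinearMap.toMatrix'_id, ← hα]
      rfl
    simp [this]
  · intro F hF hdetF
    have hrange : LinearMap.range (p ∘ₗ L F) = ⊤ := by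
      refine LinearMap.range_eq_top.2 fun y => ⟨α ((M F)⁻¹.mulVec y), ?_⟩
      rw [LinearMap.comp_apply, hM, Matrix.mulVec_mulVec,
        Matrix.mul_nonsing_inv _ (isUnit_iff_ne_zero.2 hdetF), Matrix.one_mulVec]
    have hLF : ∀ c, L F c = 0 → c = 0 := fun c hc => by
      rw [Fintype.linearCombination_apply] at hc
      exact funext (Fintype.linearIndependent_iff.1 hF c hc)
    have hinj : LinearMap.ker (f ∘ₗ L F ∘ₗ γ F) = ⊥ := by
      refine (Submodule.eq_bot_iff _).2 fun c hc => hγ F hdetF c (hLF _ ?_)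
      have : L F (γ F c) ∈ LinearMap.ker f ⊓ LinearMap.ker p := ⟨hc, hpγ F c⟩
      rwa [hfp] at this
    -- `γ F` is injective into a kernel of the same dimension `m'`, so it parametrizes all of it.
    have hγrange : LinearMap.range (γ F) = LinearMap.ker (p ∘ₗ L F) := by
      refine Submodule.eq_of_le_of_finrank_le ?_ ?_
      · rintro _ ⟨c, rfl⟩
        exact hpγ F c
      · rw [hker F hrange, LinearMap.finrank_range_of_inj
          ((injective_iff_map_eq_zero _).2 (hγ F hdetF)), Module.finrank_fin_fun]
    have hP : (fun t => f (L F (γ F (Pi.single t 1)))) =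
        (f ∘ₗ L F ∘ₗ γ F) ∘ Pi.basisFun k (Fin m') := by
      funext t
      simp
    refine ⟨(hsurj F).2 hrange, ?_, ?_⟩ <;> beta_reduce
    · rw [hP]
      exact (Pi.basisFun k (Fin m')).linearIndependent.map' _ hinj
    · rw [hP, Set.range_comp, ← Submodule.map_span, (Pi.basisFun k (Fin m')).span_eq,
        ← LinearMap.range_eq_map, LinearMap.range_comp, LinearMap.range_comp, hγrange,
        LinearMap.ker_comp, Submodule.map_comap_eq, hL]

end Frames

/-! ### Varieties of subalgebras under surjective homomorphisms -/

section SubalgebraVariety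

variable {k B C : Type*} [Field k] [Ring B] [Algebra k B] [Ring C] [Algebra k C]
  [Module.Finite k B] {d m m' : ℕ}

/-- The points of the variety of subalgebras. -/
def subalgebraPoints (k B : Type*) [Field k] [Ring B] [Algebra k B] (m : ℕ) :
    Set (SubspaceOfDim k B m) :=
  {W | ∃ A : Subalgebra k B, Subalgebra.toSubmodule A = W.1}

theorem finrank_map_add_of_ker_le {V V' : Type*} [AddCommGroup V] [Module k V] [AddCommGroup V']
    [Module k V'] [Module.Finite k V] (f : V →ₗ[k] V') (W : Submodule k V)
    (hW : LinearMap.ker f ≤ W) :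
    Module.finrank k (W.map f) + Module.finrank k (LinearMap.ker f) = Module.finrank k W := by
  have h := LinearMap.finrank_range_add_finrank_ker (f ∘ₗ W.subtype)
  rw [LinearMap.range_comp, Submodule.range_subtype, LinearMap.ker_comp] at h
  rw [← h, ← (Submodule.comapSubtypeEquivOfLe hW).finrank_eq]

/-- If every `m`-dimensional subalgebra contains the kernel of a surjective algebra homomorphism,
then taking images is an isomorphism between varieties of subalgebras. -/
theorem exists_algGr_iso_of_surjective (f : B →ₐ[k] C) (hf : Function.Surjective f)
    (hd : Module.finrank k (LinearMap.ker f.toLinearMap) = d) (hm : m = d + m')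
    (hker : ∀ A : Subalgebra k B, Module.finrank k A = m → ∀ x, f x = 0 → x ∈ A) :
    ∃ e : SpaceWithFunctions.Iso (algGr k B m) (algGr k C m'),
      ∀ A : (algGr k B m).carrier,
        algGr.space (e.toEquiv A) = (algGr.space A).map f.toLinearMap := by
  set g : B →ₗ[k] C := f.toLinearMap
  have hgsurj : Function.Surjective g := hf
  have hcontain : ∀ W ∈ subalgebraPoints k B m, LinearMap.ker g ≤ W.1 := by
    rintro ⟨W, hW⟩ ⟨A, rfl⟩ x hx
    exact hker A hW x hx
  have hmap : ∀ W : SubspaceOfDim k B m, W ∈ subalgebraPoints k B m →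
      Module.finrank k (W.1.map g) = m' := by
    intro W hW
    have := finrank_map_add_of_ker_le g W.1 (hcontain W hW)
    rw [hd, W.2] at this
    omega
  have hcomap : ∀ W : SubspaceOfDim k C m', Module.finrank k (W.1.comap g) = m := by
    intro W
    have := finrank_map_add_of_ker_le g (W.1.comap g) (LinearMap.ker_le_comap g)
    rw [Submodule.map_comap_eq_of_surjective hgsurj, W.2, hd] at this
    omega
  let e : subalgebraPoints k B m ≃ subalgebraPoints k C m' :=
    { toFun := fun W => ⟨⟨W.1.1.map g, hmap W.1 W.2⟩, by
        obtain ⟨A, hA⟩ := W.2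
        exact ⟨A.map f, congr_arg (Submodule.map g) hA⟩⟩
      invFun := fun W => ⟨⟨W.1.1.comap g, hcomap W.1⟩, by
        obtain ⟨A, hA⟩ := W.2
        exact ⟨A.comap f, congr_arg (Submodule.comap g) hA⟩⟩
      left_inv := fun W => Subtype.ext (Subtype.ext
        (Submodule.comap_map_eq_self (hcontain W.1 W.2)))
      right_inv := fun W => Subtype.ext (Subtype.ext
        (Submodule.map_comap_eq_of_surjective hgsurj W.1.1)) }
  obtain ⟨s, hs⟩ := g.exists_rightInverse_of_surjective (LinearMap.range_eq_top.2 hgsurj)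
  let b : (Fin d → k) ≃ₗ[k] LinearMap.ker g :=
    LinearEquiv.ofFinrankEq _ _ (by rw [hd, Module.finrank_fin_fun])
  -- Coordinates of the projection onto `ker g` determined by the section `s`; its kernel is a
  -- complement of `ker g`.
  let p : B →ₗ[k] (Fin d → k) := b.symm.toLinearMap ∘ₗ
    (LinearMap.id - s ∘ₗ g).codRestrict (LinearMap.ker g) fun x => by
      have : g (s (g x)) = g x := LinearMap.congr_fun hs (g x)
      simp [this]
  have hp : ∀ x (hx : x ∈ LinearMap.ker g), p x = b.symm ⟨x, hx⟩ := by
    intro x hx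
    simp only [p, LinearMap.comp_apply, LinearEquiv.coe_coe]
    congr 1
    ext
    rw [LinearMap.mem_ker] at hx
    simp [hx]
  have hgp : LinearMap.ker g ⊓ LinearMap.ker p = ⊥ := by
    refine (Submodule.eq_bot_iff _).2 fun x hx => ?_
    have h : p x = 0 := hx.2
    rw [hp x hx.1] at h
    simpa using h
  have hpsurj : ∀ W : Submodule k B, LinearMap.ker g ≤ W → W.map p = ⊤ := by
    intro W hW
    refine eq_top_iff.2 fun y _ => ⟨(b y : B), hW (b y).2, ?_⟩
    rw [hp _ (b y).2]
    simp
  have hinf : ∀ W : Submodule k B, LinearMap.ker g ≤ W →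
      W.map g = (W ⊓ LinearMap.ker p).map g := by
    intro W hW
    refine le_antisymm ?_ (Submodule.map_mono inf_le_left)
    rintro _ ⟨x, hx, rfl⟩
    -- Subtracting the `ker g` component stays in `W`, lands in `ker p` and does not change the
    -- image under `g`.
    refine ⟨x - b (p x), ⟨sub_mem hx (hW (b (p x)).2), ?_⟩, ?_⟩
    · rw [SetLike.mem_coe, LinearMap.mem_ker, map_sub, hp _ (b (p x)).2]
      simp
    · rw [map_sub, LinearMap.mem_ker.1 (b (p x)).2, sub_zero]
  have h1 := (isLocallyPoly_map_inf_ker g p hgp hm).isMorphism (subalgebraPoints k B m)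
    (subalgebraPoints k C m') (fun W hW => hpsurj W.1 (hcontain W hW)) e
    fun W => hinf W.1.1 (hcontain W.1 W.2)
  have h2 := (isLocallyPoly_comap g s hs ((LinearMap.ker g).subtype ∘ₗ b.toLinearMap)
    (LinearMap.ker_eq_bot.2 (Subtype.val_injective.comp b.injective))
    (by rw [LinearMap.range_comp, LinearEquiv.range, Submodule.map_top, Submodule.range_subtype])
    hm).isMorphism (subalgebraPoints k C m')
    (subalgebraPoints k B m) (fun _ _ => trivial) e.symm fun _ => rfl
  exact ⟨SpaceWithFunctions.Iso.ofIsMorphism (X := algGr k B m) (Y := algGr k C m') e h1 h2,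
    fun _ => rfl⟩

/-- Reduction modulo a power of a nilpotent ideal. -/
theorem exists_algGr_iso_of_ker_eq (J : Ideal B) [J.IsTwoSided] (hJ : IsNilpotent J) (f : B →ₐ[k] C)
    (hf : Function.Surjective f) {r : ℕ} (hr : m + r = Module.finrank k B)
    (hker : ∀ x, f x = 0 ↔ x ∈ J ^ (2 * r)) (hm' : m' + r = Module.finrank k C) :
    ∃ e : SpaceWithFunctions.Iso (algGr k B m) (algGr k C m'),
      ∀ A : (algGr k B m).carrier,
        algGr.space (e.toEquiv A) = (algGr.space A).map f.toLinearMap := by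
  refine exists_algGr_iso_of_surjective f hf rfl (m := m) (m' := m') ?_ fun A hA x hx =>
    idealPow_le_subalgebra J hJ A r (by omega) ((hker x).1 hx)
  have h := LinearMap.finrank_range_add_finrank_ker f.toLinearMap
  rw [LinearMap.range_eq_top.2 hf, finrank_top] at h
  omega

/-- If `J ^ (2r) = 0` then `C` has the dimension of `B`. Otherwise the strictly decreasing powers
give `dim C ≥ 2r`. This is the nonnegativity of the reduced dimension. -/
theorem le_finrank_of_ker_eq (J : Ideal B) [J.IsTwoSided] (hJ : IsNilpotent J) (f : B →ₐ[k] C)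
    (hf : Function.Surjective f) {r : ℕ} (hr : r ≤ Module.finrank k B)
    (hker : ∀ x, f x = 0 ↔ x ∈ J ^ (2 * r)) : r ≤ Module.finrank k C := by
  have h := LinearMap.finrank_range_add_finrank_ker f.toLinearMap
  rw [LinearMap.range_eq_top.2 hf, finrank_top] at h
  have hk : LinearMap.ker f.toLinearMap = idealPow k J (2 * r) := Submodule.ext hker
  rw [hk] at h
  by_cases hb : idealPow k J (2 * r) = ⊥
  · rw [hb, finrank_bot] at h
    omega
  · have := finrank_idealPow_add_le J hJ _ hb
    omega

end SubalgebraVariety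

/-! ### Path length, the arrow ideal and the radical of a bound quiver algebra -/

noncomputable section

namespace PathAlgebra

section Tail

variable (k : Type*) (Q : Type*) [Field k] [Quiver Q]

/-- The span of all paths of length at least `n`. -/
def pathTail (n : ℕ) : Submodule k (PathAlgebra k Q) :=
  Submodule.span k (basis k '' {p : QuiverPath Q | n ≤ p.path.length})

variable {k Q}

theorem ofPath_mem_pathTail {n : ℕ} {u v : Q} (p : Quiver.Path u v) (h : n ≤ p.length) :
    ofPath k p ∈ pathTail k Q n :=
  Submodule.subset_span ⟨⟨u, v, p⟩, h, rfl⟩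

theorem mem_pathTail_iff {n : ℕ} {x : PathAlgebra k Q} :
    x ∈ pathTail k Q n ↔ ∀ p : QuiverPath Q, p.path.length < n → (basis k).repr x p = 0 := by
  rw [pathTail, Module.Basis.mem_span_image]
  refine ⟨fun h p hp => ?_, fun h p hp => ?_⟩
  · by_contra hne
    exact absurd (h (Finsupp.mem_support_iff.2 hne)) (not_le.2 hp)
  · by_contra hlt
    exact Finsupp.mem_support_iff.1 hp (h p (not_le.1 hlt))

theorem pathTail_zero : pathTail k Q 0 = ⊤ :=
  eq_top_iff.2 fun _ _ => mem_pathTail_iff.2 fun _ h => absurd h (Nat.not_lt_zero _)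

theorem mul_mem_pathTail {a b : ℕ} {x y : PathAlgebra k Q} (hx : x ∈ pathTail k Q a)
    (hy : y ∈ pathTail k Q b) : x * y ∈ pathTail k Q (a + b) := by
  induction hx using Submodule.span_induction with
  | zero => rw [zero_mul]; exact zero_mem _
  | add x x' _ _ hx hx' => rw [add_mul]; exact add_mem hx hx'
  | smul c x _ hx => rw [smul_mul_assoc]; exact Submodule.smul_mem _ _ hx
  | mem x hx =>
  obtain ⟨⟨u, v, p⟩, hp, rfl⟩ := hx
  induction hy using Submodule.span_induction with
  | zero => rw [mul_zero]; exact zero_mem _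
  | add y y' _ _ hy hy' => rw [mul_add]; exact add_mem hy hy'
  | smul c y _ hy => rw [mul_smul_comm]; exact Submodule.smul_mem _ _ hy
  | mem y hy =>
  obtain ⟨⟨v', w, q⟩, hq, rfl⟩ := hy
  simp only [Set.mem_ofPred_eq] at hp hq
  rw [basis_apply, basis_apply]
  by_cases h : v = v'
  · subst h
    rw [ofPath_mul_ofPath]
    exact ofPath_mem_pathTail _ (by rw [Quiver.Path.length_comp]; exact add_le_add hp hq)
  · rw [ofPath_mul_ofPath_of_ne _ _ h]
    exact zero_mem _

theorem finite_setOf_length_eq [Finite Q] [∀ u v : Q, Finite (u ⟶ v)] (n : ℕ) :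
    {p : QuiverPath Q | p.path.length = n}.Finite := by
  induction n with
  | zero =>
    refine (Set.finite_range fun v : Q => (⟨v, v, Quiver.Path.nil⟩ : QuiverPath Q)).subset ?_
    rintro ⟨u, v, p⟩ hp
    cases p with
    | nil => exact ⟨u, rfl⟩
    | cons p a => simp at hp
  | succ n ih =>
    refine (ih.biUnion fun p _ => Set.finite_iUnion fun w : Q => Set.finite_range
      fun a : p.tgt ⟶ w => (⟨p.src, w, p.path.cons a⟩ : QuiverPath Q)).subset ?_
    rintro ⟨u, v, p⟩ hp
    cases p with
    | nil => simp at hp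
    | cons p a =>
      refine Set.mem_biUnion (x := ⟨u, _, p⟩) ?_ (Set.mem_iUnion.2 ⟨v, a, rfl⟩)
      simpa using hp

-- A finite quiver has finitely many paths of each length, so those of length less than `n` span a
-- finite-dimensional supplement.
variable (k Q) in
theorem exists_fg_sup_pathTail_eq_top [Finite Q] [∀ u v : Q, Finite (u ⟶ v)] (n : ℕ) :
    ∃ W : Submodule k (PathAlgebra k Q), W.FG ∧ W ⊔ pathTail k Q n = ⊤ := by
  have hfin : {p : QuiverPath Q | p.path.length < n}.Finite := by
    refine ((Set.finite_Iio n).biUnion fun i _ => finite_setOf_length_eq (Q := Q) i).subset ?_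
    intro p hp
    exact Set.mem_biUnion (x := p.path.length) hp rfl
  refine ⟨Submodule.span k (basis k '' {p : QuiverPath Q | p.path.length < n}),
    Submodule.fg_span (hfin.image _), ?_⟩
  rw [pathTail, ← Submodule.span_union, ← Set.image_union, ← (basis k).span_eq, ← Set.image_univ]
  congr 2
  ext p
  simpa using lt_or_ge _ _

/-- The coefficient of a trivial path is multiplicative. -/
theorem repr_nil_mul (v : Q) (x y : PathAlgebra k Q) :
    (basis k).repr (x * y) ⟨v, v, Quiver.Path.nil⟩ =
      (basis k).repr x ⟨v, v, Quiver.Path.nil⟩ * (basis k).repr y ⟨v, v, Quiver.Path.nil⟩ := by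
  induction x using induct with
  | h0 => simp
  | hadd x x' hx hx' => simp [add_mul, hx, hx']
  | hsmul c x hx => simp [smul_mul_assoc, hx, mul_assoc]
  | hpath u w p =>
  induction y using induct with
  | h0 => simp
  | hadd y y' hy hy' => simp [mul_add, hy, hy']
  | hsmul c y hy => simp [mul_smul_comm, hy, mul_left_comm]
  | hpath w' t q =>
  have hcoef : ∀ {a b : Q} (r : Quiver.Path a b), (basis k).repr (ofPath k r)
      ⟨v, v, Quiver.Path.nil⟩ = Finsupp.single (⟨a, b, r⟩ : QuiverPath Q) (1 : k)
        ⟨v, v, Quiver.Path.nil⟩ := by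
    intro a b r
    rw [← basis_apply k ⟨a, b, r⟩, Module.Basis.repr_self]
  have hcons : ∀ {a b c : Q} (r : Quiver.Path a b) (s : b ⟶ c), (basis k).repr
      (ofPath k (r.cons s)) ⟨v, v, Quiver.Path.nil⟩ = 0 := by
    intro a b c r s
    rw [hcoef]
    refine Finsupp.single_eq_of_ne fun h => ?_
    have := congr_arg (fun p : QuiverPath Q => p.path.length) h
    simp at this
  by_cases h : w = w'
  · subst h
    rw [ofPath_mul_ofPath]
    cases q with
    | cons q a => rw [Quiver.Path.comp_cons, hcons, hcons, mul_zero]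
    | nil =>
      rw [Quiver.Path.comp_nil]
      cases p with
      | cons p a => rw [hcons, zero_mul]
      | nil =>
        rw [hcoef]
        by_cases huv : u = v
        · subst huv; simp
        · rw [Finsupp.single_eq_of_ne, zero_mul]
          exact fun h => huv (congr_arg QuiverPath.src h).symm
  · rw [ofPath_mul_ofPath_of_ne _ _ h]
    cases p with
    | cons p a => rw [hcons]; simp
    | nil =>
      cases q with
      | cons q a => rw [hcons]; simp
      | nil =>
        rw [hcoef, hcoef]
        by_cases huv : u = v
        · rw [Finsupp.single_eq_of_ne (a := (⟨w', w', _⟩ : QuiverPath Q)), mul_zero]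
          · simp
          · exact fun h' => h (huv.trans (congr_arg QuiverPath.src h'))
        · rw [Finsupp.single_eq_of_ne, zero_mul]
          · simp
          · exact fun h => huv (congr_arg QuiverPath.src h).symm

end Tail

section ArrowIdeal

variable {k Q : Type*} [Field k] [Quiver Q] [Fintype Q]

instance : (arrowIdeal k Q).IsTwoSided := by
  unfold arrowIdeal
  infer_instance

/-- Lengths add under concatenation, so the paths of positive length span a two-sided ideal; it
contains the arrows. -/
theorem mem_pathTail_one_of_mem_arrowIdeal {x : PathAlgebra k Q} (hx : x ∈ arrowIdeal k Q) :
    x ∈ pathTail k Q 1 := by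
  have hall : ∀ y : PathAlgebra k Q, y ∈ pathTail k Q 0 := fun y => by rw [pathTail_zero]; trivial
  let T : TwoSidedIdeal (PathAlgebra k Q) := TwoSidedIdeal.mk' (pathTail k Q 1) (zero_mem _)
    (fun h h' => add_mem h h') (fun h => neg_mem h)
    (fun {a b} h => by simpa using mul_mem_pathTail (hall a) h)
    (fun {a b} h => by simpa using mul_mem_pathTail h (hall b))
  have h := TwoSidedIdeal.mem_span_iff.1 (TwoSidedIdeal.mem_asIdeal.1 hx) T (by
    rintro _ ⟨u, v, a, rfl⟩
    exact (TwoSidedIdeal.mem_mk' _ _ _ _ _ _ _).2 (ofPath_mem_pathTail _ le_rfl))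
  exact (TwoSidedIdeal.mem_mk' _ _ _ _ _ _ _).1 h

/-- One inclusion is additivity of length; for the other, split off the last arrow of a path and
induct. Membership in a power of the arrow ideal becomes a condition on coefficients. -/
theorem mem_arrowIdeal_pow_iff {n : ℕ} {x : PathAlgebra k Q} :
    x ∈ arrowIdeal k Q ^ n ↔ x ∈ pathTail k Q n := by
  constructor
  · intro hx
    induction n generalizing x with
    | zero => rw [pathTail_zero]; trivial
    | succ n ih =>
      rw [Submodule.pow_succ] at hx
      induction hx using Submodule.mul_induction_on' with
      | add x _ y _ hx hy => exact add_mem hx hy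
      | mem_mul_mem x hx y hy => exact mul_mem_pathTail (ih hx) (mem_pathTail_one_of_mem_arrowIdeal hy)
  · intro hx
    have hpath : ∀ n {u v : Q} (p : Quiver.Path u v), n ≤ p.length →
        ofPath k p ∈ arrowIdeal k Q ^ n := by
      intro n
      induction n with
      | zero => intro u v p _; rw [Submodule.pow_zero, Ideal.one_eq_top]; trivial
      | succ n ih =>
        intro u v p hp
        cases p with
        | nil => simp at hp
        | cons p a =>
          rw [Quiver.Path.length_cons] at hp
          have : ofPath k (p.cons a) = ofPath k p * ofPath k a.toPath := by
            rw [ofPath_mul_ofPath]; rfl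
          rw [this, Submodule.pow_succ]
          exact Ideal.mul_mem_mul (ih p (by omega)) (TwoSidedIdeal.mem_asIdeal.2
            (TwoSidedIdeal.subset_span ⟨_, _, a, rfl⟩))
    induction hx using Submodule.span_induction with
    | zero => exact zero_mem _
    | add x x' _ _ hx hx' => exact add_mem hx hx'
    | smul c x _ hx =>
      -- A power of the ideal is only known to be stable under ring multiplication, so the scalar
      -- `c` is written as left multiplication by `c • 1`.
      rw [← one_mul x, ← smul_mul_assoc]
      exact Ideal.mul_mem_left _ _ hx
    | mem x hx =>
      obtain ⟨p, hp, rfl⟩ := hx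
      exact hpath n p.path hp

theorem finite_quotient [∀ u v : Q, Finite (u ⟶ v)] (I : Ideal (PathAlgebra k Q)) [I.IsTwoSided]
    (hI : IsAdmissible I) : Module.Finite k (PathAlgebra k Q ⧸ I) := by
  obtain ⟨l, -, hl⟩ := hI.2
  obtain ⟨W, hW, htop⟩ := exists_fg_sup_pathTail_eq_top k Q l
  refine ⟨?_⟩
  have hsurj : LinearMap.range (Ideal.Quotient.mkₐ k I).toLinearMap = ⊤ :=
    LinearMap.range_eq_top.2 Ideal.Quotient.mk_surjective
  have hzero : (pathTail k Q l).map (Ideal.Quotient.mkₐ k I).toLinearMap = ⊥ := by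
    refine (Submodule.eq_bot_iff _).2 ?_
    rintro _ ⟨x, hx, rfl⟩
    exact Ideal.Quotient.eq_zero_iff_mem.2 (hl (mem_arrowIdeal_pow_iff.2 hx))
  rw [← hsurj, LinearMap.range_eq_map, ← htop, Submodule.map_sup, hzero, sup_bot_eq]
  exact hW.map _

/-- The Jacobson radical of a bound quiver algebra is generated by the arrows. -/
theorem mk_mem_jacobson_iff [∀ u v : Q, Finite (u ⟶ v)] (I : Ideal (PathAlgebra k Q))
    [I.IsTwoSided] (hI : IsAdmissible I) (a : PathAlgebra k Q) :
    Ideal.Quotient.mk I a ∈ Ring.jacobson (PathAlgebra k Q ⧸ I) ↔ a ∈ arrowIdeal k Q := by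
  have := finite_quotient I hI
  have : IsArtinianRing (PathAlgebra k Q ⧸ I) := IsArtinianRing.of_finite k _
  constructor
  · intro ha
    -- The radical is nilpotent, so `a ^ N` lies in `I` and hence in `J(Q)²`. Its coefficients at
    -- trivial paths vanish, and these are multiplicative, so those of `a` vanish as well.
    obtain ⟨N, hN⟩ := IsSemiprimaryRing.isNilpotent (R := PathAlgebra k Q ⧸ I)
    have h := Ideal.pow_mem_pow ha N
    rw [hN, ← map_pow] at h
    have h' := hI.1 (Ideal.Quotient.eq_zero_iff_mem.1 h)
    rw [mem_arrowIdeal_pow_iff, mem_pathTail_iff] at h'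
    rw [← Submodule.pow_one (arrowIdeal k Q), mem_arrowIdeal_pow_iff, mem_pathTail_iff]
    rintro ⟨u, v, p⟩ hp
    cases p with
    | cons p b => simp at hp
    | nil =>
      have hpow : ∀ n, (basis k).repr (a ^ (n + 1)) ⟨u, u, Quiver.Path.nil⟩ =
          (basis k).repr a ⟨u, u, Quiver.Path.nil⟩ ^ (n + 1) := by
        intro n
        induction n with
        | zero => simp
        | succ n ih => rw [pow_succ, repr_nil_mul, ih, pow_succ _ (n + 1)]
      have h0 : (basis k).repr (a ^ (N + 1)) ⟨u, u, Quiver.Path.nil⟩ = 0 := by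
        rw [pow_succ, repr_nil_mul, h' ⟨u, u, Quiver.Path.nil⟩ (by simp), zero_mul]
      rw [hpow] at h0
      exact pow_eq_zero_iff (by omega) |>.1 h0
  · intro ha
    rw [← Ideal.jacobson_bot, Ideal.mem_jacobson_iff]
    intro y
    obtain ⟨b, rfl⟩ := Ideal.Quotient.mk_surjective y
    obtain ⟨l, -, hl⟩ := hI.2
    -- Since `(b * a) ^ l` lies in `J(Q) ^ l ⊆ I`, the class of `1 + b * a` is invertible, which is
    -- the quasi-regularity criterion for the radical.
    have hnil : IsNilpotent (Ideal.Quotient.mk I b * Ideal.Quotient.mk I a) := by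
      refine ⟨l, ?_⟩
      rw [← map_mul, ← map_pow]
      exact Ideal.Quotient.eq_zero_iff_mem.2 (hl (Ideal.pow_mem_pow (Ideal.mul_mem_left _ b ha) l))
    obtain ⟨z, hz⟩ := hnil.isUnit_one_add.exists_left_inv
    refine ⟨z, ?_⟩
    rw [Submodule.mem_bot, sub_eq_zero, ← hz]
    noncomm_ring

/-- A homomorphism from a path algebra with kernel the square of the arrow ideal induces a
homomorphism from every bound quiver algebra, with kernel the square of the radical. -/
theorem exists_algHom_ker_eq_jacobson_sq [∀ u v : Q, Finite (u ⟶ v)] (I : Ideal (PathAlgebra k Q))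
    [I.IsTwoSided] (hI : IsAdmissible I) {C : Type*} [Ring C] [Algebra k C]
    (g : PathAlgebra k Q →ₐ[k] C) (hg : Function.Surjective g)
    (hker : ∀ x, g x = 0 ↔ x ∈ arrowIdeal k Q ^ 2) :
    ∃ f : (PathAlgebra k Q ⧸ I) →ₐ[k] C, Function.Surjective f ∧
      ∀ x, f x = 0 ↔ x ∈ Ring.jacobson (PathAlgebra k Q ⧸ I) ^ 2 := by
  let f : (PathAlgebra k Q ⧸ I) →ₐ[k] C :=
    Ideal.Quotient.liftₐ I g fun a ha => (hker a).2 (hI.1 ha)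
  have hf : ∀ a, f (Ideal.Quotient.mk I a) = g a := fun a => rfl
  refine ⟨f, fun c => (hg c).imp' (Ideal.Quotient.mk I) fun a ha => ha, fun x => ⟨fun hx => ?_, ?_⟩⟩
  · obtain ⟨a, rfl⟩ := Ideal.Quotient.mk_surjective x
    rw [hf, hker] at hx
    have hle : arrowIdeal k Q ^ 2 ≤
        (Ring.jacobson (PathAlgebra k Q ⧸ I) ^ 2).comap (Ideal.Quotient.mk I) := by
      rw [Submodule.pow_succ, Submodule.pow_one, Submodule.pow_succ, Submodule.pow_one,
        Ideal.mul_le]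
      intro r hr s hs
      rw [Ideal.mem_comap, map_mul]
      exact Ideal.mul_mem_mul ((mk_mem_jacobson_iff I hI r).2 hr) ((mk_mem_jacobson_iff I hI s).2 hs)
    exact hle hx
  -- Here the other direction of `mk_mem_jacobson_iff` is needed: every lift of a radical element
  -- lies in the arrow ideal.
  · have hle : Ring.jacobson (PathAlgebra k Q ⧸ I) ^ 2 ≤ RingHom.ker f := by
      rw [Submodule.pow_succ, Submodule.pow_one, Ideal.mul_le]
      intro r hr s hs
      obtain ⟨a, rfl⟩ := Ideal.Quotient.mk_surjective r
      obtain ⟨b, rfl⟩ := Ideal.Quotient.mk_surjective s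
      rw [RingHom.mem_ker, ← map_mul, hf, hker, Submodule.pow_succ, Submodule.pow_one]
      exact Ideal.mul_mem_mul ((mk_mem_jacobson_iff I hI a).1 hr) ((mk_mem_jacobson_iff I hI b).1 hs)
    exact fun hx => hle hx

end ArrowIdeal

/-! ### Isomorphic quivers have isomorphic path algebras -/

section Functoriality

variable {k Q Q' : Type*} [Field k] [Quiver Q] [Quiver Q']

/-- The prefunctor underlying an isomorphism of quivers. -/
def prefunctorOfEquiv (e : Q ≃ Q') (φ : ∀ u v : Q, (u ⟶ v) ≃ (e u ⟶ e v)) : Q ⥤q Q' where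
  obj := e
  map {u v} := φ u v

theorem length_mapPath (F : Q ⥤q Q') {u v : Q} (p : Quiver.Path u v) :
    (F.mapPath p).length = p.length := by
  induction p with
  | nil => rfl
  | cons p a ih => simp [ih]

/-- The bijection on paths induced by an isomorphism of quivers. -/
def pathEquiv (e : Q ≃ Q') (φ : ∀ u v : Q, (u ⟶ v) ≃ (e u ⟶ e v)) : QuiverPath Q ≃ QuiverPath Q' :=
  Equiv.ofBijective
    (fun p => ⟨_, _, (prefunctorOfEquiv e φ).mapPath p.path⟩) (by
    -- Bijectivity on the arrows leaving each vertex propagates to the paths leaving each vertex.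
    have hstar : ∀ u, Function.Bijective ((prefunctorOfEquiv e φ).star u) := fun u =>
      (Equiv.sigmaCongr e (φ u)).bijective
    constructor
    · rintro ⟨u, v, p⟩ ⟨u', v', p'⟩ h
      obtain rfl : u = u' := e.injective (congr_arg QuiverPath.src h)
      have h2 := (prefunctorOfEquiv e φ).pathStar_injective (fun u => (hstar u).1) u
        (a₁ := ⟨v, p⟩) (a₂ := ⟨v', p'⟩) (by
          simp only [QuiverPath.mk.injEq, true_and] at h
          exact Sigma.ext h.1 h.2)
      cases h2
      rfl
    · rintro ⟨u, v, p⟩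
      obtain ⟨u, rfl⟩ := e.surjective u
      obtain ⟨⟨w, q⟩, h⟩ := (prefunctorOfEquiv e φ).pathStar_surjective (fun u => (hstar u).2) u
        ⟨v, p⟩
      cases h
      exact ⟨⟨u, w, q⟩, rfl⟩)

/-- The map permutes the path bases and preserves length, so it respects the coefficient description
of the powers of the arrow ideal in both directions. -/
theorem exists_algHom_of_quiverIso [Fintype Q] [Fintype Q'] (e : Q ≃ Q')
    (φ : ∀ u v : Q, (u ⟶ v) ≃ (e u ⟶ e v)) :
    ∃ Φ : PathAlgebra k Q →ₐ[k] PathAlgebra k Q', Function.Surjective Φ ∧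
      ∀ n x, Φ x ∈ arrowIdeal k Q' ^ n ↔ x ∈ arrowIdeal k Q ^ n := by
  let Φ₀ : PathAlgebra k Q ≃ₗ[k] PathAlgebra k Q' := (basis k).equiv (basis k) (pathEquiv e φ)
  have hΦ : ∀ {u v : Q} (p : Quiver.Path u v),
      Φ₀ (ofPath k p) = ofPath k ((prefunctorOfEquiv e φ).mapPath p) := fun {u v} p =>
    (basis k).equiv_apply ⟨u, v, p⟩ (basis k) (pathEquiv e φ)
  have hone : Φ₀ 1 = 1 := by
    rw [one_def, one_def, map_sum, ← e.sum_comp]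
    exact Finset.sum_congr rfl fun v _ => hΦ _
  have hmul : ∀ x y, Φ₀ (x * y) = Φ₀ x * Φ₀ y := by
    intro x y
    induction x using induct with
    | h0 => simp
    | hadd x x' hx hx' => simp [add_mul, hx, hx']
    | hsmul c x hx => simp only [smul_mul_assoc, map_smul, hx]
    | hpath u v p =>
    induction y using induct with
    | h0 => simp
    | hadd y y' hy hy' => simp [mul_add, hy, hy']
    | hsmul c y hy => simp only [mul_smul_comm, map_smul, hy]
    | hpath v' w q =>
    rw [hΦ, hΦ]
    by_cases h : v = v'
    · subst h
      rw [ofPath_mul_ofPath, ofPath_mul_ofPath, hΦ, Prefunctor.mapPath_comp]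
    · rw [ofPath_mul_ofPath_of_ne _ _ h, map_zero]
      exact (ofPath_mul_ofPath_of_ne _ _ (e.injective.ne h)).symm
  refine ⟨AlgHom.ofLinearMap Φ₀.toLinearMap hone hmul, Φ₀.surjective, fun n x => ?_⟩
  rw [mem_arrowIdeal_pow_iff, mem_arrowIdeal_pow_iff, mem_pathTail_iff, mem_pathTail_iff]
  have hrepr : ∀ p, (basis k).repr (Φ₀ x) (pathEquiv e φ p) = (basis k).repr x p := by
    intro p
    have h : ((basis k).reindex (pathEquiv e φ).symm).repr (Φ₀ x) = (basis k).repr x :=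
      LinearEquiv.apply_symm_apply _ _
    rw [← h, Module.Basis.repr_reindex_apply, Equiv.symm_symm]
  constructor
  · intro h p hp
    rw [← hrepr p]
    exact h _ (by rwa [← length_mapPath (prefunctorOfEquiv e φ)] at hp)
  · intro h p hp
    obtain ⟨p, rfl⟩ := (pathEquiv e φ).surjective p
    refine (hrepr p).trans (h p ?_)
    rwa [← length_mapPath (prefunctorOfEquiv e φ)]

end Functoriality

end PathAlgebra

end

/-! ### Bound quiver algebras: the two statements -/

theorem isNilpotent_jacobson_of_finite (k B : Type*) [Field k] [Ring B] [Algebra k B]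
    [Module.Finite k B] : IsNilpotent (Ring.jacobson B) :=
  have : IsArtinianRing B := IsArtinianRing.of_finite k B
  IsSemiprimaryRing.isNilpotent

/-- The variety of subalgebras of codimension one is that of the quotient by the radical square. -/
theorem PathAlgebra.nonempty_algGr_iso {k Q C : Type*} [Field k] [Quiver Q] [Fintype Q]
    [∀ u v : Q, Finite (u ⟶ v)] (I : Ideal (PathAlgebra k Q)) [I.IsTwoSided]
    (hI : PathAlgebra.IsAdmissible I) [Ring C] [Algebra k C] (g : PathAlgebra k Q →ₐ[k] C)
    (hg : Function.Surjective g) (hker : ∀ x, g x = 0 ↔ x ∈ PathAlgebra.arrowIdeal k Q ^ 2)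
    {m : ℕ} (hm : m + 1 = Module.finrank k (PathAlgebra k Q ⧸ I)) :
    Nonempty (SpaceWithFunctions.Iso (algGr k (PathAlgebra k Q ⧸ I) m)
      (algGr k C (Module.finrank k C - 1))) := by
  have := PathAlgebra.finite_quotient I hI
  obtain ⟨f, hf, hfker⟩ := PathAlgebra.exists_algHom_ker_eq_jacobson_sq I hI g hg hker
  have hnil := isNilpotent_jacobson_of_finite k (PathAlgebra k Q ⧸ I)
  -- This gives `1 ≤ dim C`, so the truncated subtraction in `Module.finrank k C - 1` is exact.
  have hle := le_finrank_of_ker_eq _ hnil f hf (r := 1) (by omega) hfker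
  obtain ⟨e, -⟩ := exists_algGr_iso_of_ker_eq _ hnil f hf (r := 1) hm hfker
    (Nat.sub_add_cancel hle)
  exact ⟨e⟩

theorem lemmat {k : Type*} [Field k] [IsAlgClosed k]
    {Q : Type*} [Quiver Q] [Fintype Q] [∀ u v : Q, Finite (u ⟶ v)]
    (I : Ideal (PathAlgebra k Q)) [I.IsTwoSided] (hI : PathAlgebra.IsAdmissible I)
    (n : ℕ) (hn : n = Module.finrank k (PathAlgebra k Q ⧸ I)) :
    -- finite dimensionality and the reduction modulo a power of the radical
    (Module.Finite k (PathAlgebra k Q ⧸ I) ∧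
      ∀ m : ℕ, 1 ≤ m → m ≤ n →
      (∀ A : Subalgebra k (PathAlgebra k Q ⧸ I), Module.finrank k A = m →
        ∀ x ∈ Ring.jacobson (PathAlgebra k Q ⧸ I) ^ (2 * (n - m)), x ∈ A) ∧
      ∃ mbar : ℕ,
        (mbar : ℤ) = (Module.finrank k ((PathAlgebra k Q ⧸ I) ⧸
          Ring.jacobson (PathAlgebra k Q ⧸ I) ^ (2 * (n - m))) : ℤ) - n + m ∧
        ∃ e : SpaceWithFunctions.Iso (algGr k (PathAlgebra k Q ⧸ I) m)
            (algGr k ((PathAlgebra k Q ⧸ I) ⧸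
              Ring.jacobson (PathAlgebra k Q ⧸ I) ^ (2 * (n - m))) mbar),
          ∀ A : (algGr k (PathAlgebra k Q ⧸ I) m).carrier,
            algGr.space (e.toEquiv A) = (algGr.space A).map
              (Ideal.Quotient.mkₐ k
                (Ring.jacobson (PathAlgebra k Q ⧸ I) ^ (2 * (n - m)))).toLinearMap) ∧
    -- the variety of subalgebras of codimension one depends only on the quiver
    (∀ (Q' : Type*) [Quiver Q'] [Fintype Q'] [∀ u v : Q', Finite (u ⟶ v)]
      (e₀ : Q ≃ Q') (_ : ∀ u v : Q, (u ⟶ v) ≃ (e₀ u ⟶ e₀ v))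
      (I' : Ideal (PathAlgebra k Q')) [I'.IsTwoSided] (_ : PathAlgebra.IsAdmissible I')
      (m m' : ℕ), m + 1 = Module.finrank k (PathAlgebra k Q ⧸ I) →
      m' + 1 = Module.finrank k (PathAlgebra k Q' ⧸ I') →
      Nonempty (SpaceWithFunctions.Iso (algGr k (PathAlgebra k Q ⧸ I) m)
        (algGr k (PathAlgebra k Q' ⧸ I') m'))) := by
  have hfin := PathAlgebra.finite_quotient I hI
  have hnil := isNilpotent_jacobson_of_finite k (PathAlgebra k Q ⧸ I)
  refine ⟨⟨hfin, fun m _ hmn => ⟨fun A hA x hx => ?_, ?_⟩⟩, ?_⟩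
  · exact idealPow_le_subalgebra (k := k) _ hnil A (n - m) (by omega) hx
  · let f := Ideal.Quotient.mkₐ k (Ring.jacobson (PathAlgebra k Q ⧸ I) ^ (2 * (n - m)))
    have hf : Function.Surjective f := Ideal.Quotient.mk_surjective
    have hker : ∀ x, f x = 0 ↔ x ∈ Ring.jacobson (PathAlgebra k Q ⧸ I) ^ (2 * (n - m)) :=
      fun _ => Ideal.Quotient.eq_zero_iff_mem
    have hle := le_finrank_of_ker_eq _ hnil f hf (by omega) hker
    -- The witness is `dim (B / J(B) ^ (2(n - m))) - (n - m)`; `hle` makes this natural subtraction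
    -- agree with the integer formula.
    refine ⟨_ - (n - m), ?_, exists_algGr_iso_of_ker_eq _ hnil f hf (by omega) hker
      (Nat.sub_add_cancel hle)⟩
    rw [Nat.cast_sub hle, Nat.cast_sub hmn]
    ring
  · intro Q' _ _ _ e₀ φ I' _ hI' m m' hm hm'
    obtain ⟨Φ, hΦ, hΦ'⟩ := PathAlgebra.exists_algHom_of_quiverIso (k := k) e₀ φ
    -- Both algebras are compared with the common quotient `kQ'/J(Q')²`, the first one through the
    -- quiver isomorphism.
    let π := Ideal.Quotient.mkₐ k (PathAlgebra.arrowIdeal k Q' ^ 2)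
    have hπ : Function.Surjective π := Ideal.Quotient.mk_surjective
    have hπker : ∀ x, π x = 0 ↔ x ∈ PathAlgebra.arrowIdeal k Q' ^ 2 :=
      fun _ => Ideal.Quotient.eq_zero_iff_mem
    obtain ⟨e⟩ := PathAlgebra.nonempty_algGr_iso I hI (π.comp Φ) (hπ.comp hΦ)
      (fun x => (hπker (Φ x)).trans (hΦ' 2 x)) hm
    obtain ⟨e'⟩ := PathAlgebra.nonempty_algGr_iso I' hI' π hπ hπker hm'
    exact ⟨e.trans e'.symm⟩
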